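/- Let $\mathbb N=\{1,2,3,\dots\}$, let $R=\mathbb K[x_j \mid j\in\mathbb N]$ be the polynomial ring over a field $\mathbb K$, and let $\mathrm{Inc}(\mathbb N)$ be the monoid of strictly increasing functions $p:\mathbb N\to\mathbb N$, acting on monomials by $p\cdot\prod_j x_j^{e_j}=\prod_j x_{p(j)}^{e_j}$. A relation $\prec$ on the monomials of $R$ is called $\mathrm{Inc}(\mathbb N)$-compatible if $f\prec g$ implies $p\cdot f\prec p\cdot g$ for all monomials $f,g$ and all $p\in\mathrm{Inc}(\mathbb N)$. A *monomial preorder* on $R$ is a strict partial order $\prec$ on the monomials of $R$ such that, for all monomials $f,g,h$, $f\prec g$ if and only if $hf\prec hg$, and such that incomparability with respect to $\prec$ is transitive. It is *trivial* if all pairs of monomials are incomparable. Its inverse $\prec^{-1}$ is defined by $f\prec^{-1}g\Leftrightarrow g\prec f$. A *term order* on $R$ is a total order $\preceq$ on the monomials that respects multiplication and satisfies $1\preceq f$ for every monomial $f$. For finitely supported exponent vectors $a,b:\mathbb N\to\mathbb N_0$ put $A=\{j\mid a_j\neq b_j\}$ and $x^a=\prod_j x_j^{a_j}$; conditions involving $\min(A)$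 or $\max(A)$ are understood to include $A\neq\emptyset$. **Theorem.** The nontrivial $\mathrm{Inc}(\mathbb N)$-compatible monomial preorders on $R$ are exactly the following relations $x^a\prec x^b$ and their inverses, where $i$ ranges over all of $\mathbb N$: 1. $\mathrm{Deg}$: $\deg(x^a)<\deg(x^b)$; 2. $\mathrm{Min}$: $a_{\min(A)}<b_{\min(A)}$; 3. $\mathrm{DegMin}$: $\deg(x^a)<\deg(x^b)$, or $\deg(x^a)=\deg(x^b)$ and $a_{\min(A)}<b_{\min(A)}$; 4. $\mathrm{RevdegMin}$: $\deg(x^a)>\deg(x^b)$, or $\deg(x^a)=\deg(x^b)$ and $a_{\min(A)}<b_{\min(A)}$; 5. $\mathrm{Max}_i$: $\max(A)\ge i$ and $a_{\max(A)}<b_{\max(A)}$; 6. $\mathrm{DegMax}_i$: $\deg(x^a)<\deg(x^b)$, or $\deg(x^a)=\deg(x^b)$, $\max(A)\ge i$ and $a_{\max(A)}<b_{\max(A)}$; 7. $\mathrm{RevdegMax}_i$: $\deg(x^a)>\deg(x^b)$, or $\deg(x^a)=\deg(x^b)$, $\max(A)\ge i$ and $a_{\max(A)}<b_{\max(A)}$.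 In particular, there are exactly six $\mathrm{Inc}(\mathbb N)$-compatible term orders on $R$, namely the total orders $f\preceq g:\Leftrightarrow\neg(g\prec f)$ associated with $\mathrm{Min}$, $\mathrm{DegMin}$, $\mathrm{RevdegMin}^{-1}$, $\mathrm{Max}_1$, $\mathrm{DegMax}_2$ and $\mathrm{RevdegMax}_2^{-1}$. -/

import Mathlib

namespace IncOrders

/-- Monomials of the polynomial ring `R = K[x₁, x₂, x₃, …]`, identified with their exponent
vectors: `a` stands for `x^a = ∏ j, x_j ^ (a j)`. Multiplication of monomials is addition of
exponent vectors, the monomial `1` is `0`, and the degree is `Finsupp.degree`. -/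
abbrev Mon : Type := ℕ+ →₀ ℕ

/-- The action of `p : ℕ → ℕ` on monomials, `p · ∏ x_j ^ (e_j) = ∏ x_{p j} ^ (e_j)`. -/
noncomputable def act (p : ℕ+ → ℕ+) (f : Mon) : Mon := Finsupp.mapDomain p f

/-- `Inc(ℕ)`-compatibility of a relation on monomials; `Inc(ℕ)` is the monoid of strictly
increasing functions `ℕ → ℕ`, where `ℕ = {1, 2, 3, …}`. -/
def IncCompatible (r : Mon → Mon → Prop) : Prop :=
  ∀ p : ℕ+ → ℕ+, StrictMono p → ∀ f g : Mon, r f g → r (act p f) (act p g)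

/-- Incomparability with respect to a strict partial order. -/
def Incomparable (r : Mon → Mon → Prop) (f g : Mon) : Prop := ¬ r f g ∧ ¬ r g f

/-- A monomial preorder on `R`: a strict partial order on the monomials which is multiplicative
and cancellative and for which incomparability is transitive. -/
structure IsMonomialPreorder (r : Mon → Mon → Prop) : Prop where
  irrefl : ∀ f, ¬ r f f
  trans : ∀ f g h, r f g → r g h → r f h
  mul : ∀ f g h, r f g → r (h + f) (h + g)
  cancel : ∀ f g h, r (h + f) (h + g) → r f g
  incomparable_trans : ∀ f g h, Incomparable r f g → Incomparable r g h → Incomparable r f h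

/-- A monomial preorder is trivial if all pairs of monomials are incomparable. -/
def IsTrivial (r : Mon → Mon → Prop) : Prop := ∀ f g, Incomparable r f g

/-- A term order on `R`: a total order `⪯` on the monomials which respects multiplication and
satisfies `1 ⪯ f` for every monomial `f`. -/
structure IsTermOrder (le : Mon → Mon → Prop) : Prop where
  refl : ∀ f, le f f
  antisymm : ∀ f g, le f g → le g f → f = g
  trans : ∀ f g h, le f g → le g h → le f h
  total : ∀ f g, le f g ∨ le g f
  mul : ∀ f g h, le f g → le (h + f) (h + g)
  one_le : ∀ f, le 0 f

/-- The inverse `≺⁻¹` of a relation `≺`. -/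
def inverse (r : Mon → Mon → Prop) : Mon → Mon → Prop := fun f g => r g f

/-- The relation `f ⪯ g :⇔ ¬ (f ≻ g)` associated with `≺`. -/
def weak (r : Mon → Mon → Prop) : Mon → Mon → Prop := fun f g => ¬ r g f

/-- The set `A = {j | a_j ≠ b_j}`. -/
def diffSet (a b : Mon) : Set ℕ+ := {j | a j ≠ b j}

/-- `Deg`: `deg(x^a) < deg(x^b)`. -/
def ordDeg (a b : Mon) : Prop := Finsupp.degree a < Finsupp.degree b

/-- `Min`: `a_{min(A)} < b_{min(A)}` (in particular `A` is nonempty). -/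
def ordMin (a b : Mon) : Prop := ∃ j, IsLeast (diffSet a b) j ∧ a j < b j

/-- `DegMin`. -/
def ordDegMin (a b : Mon) : Prop :=
  Finsupp.degree a < Finsupp.degree b ∨ (Finsupp.degree a = Finsupp.degree b ∧ ordMin a b)

/-- `RevdegMin`. -/
def ordRevdegMin (a b : Mon) : Prop :=
  Finsupp.degree a > Finsupp.degree b ∨ (Finsupp.degree a = Finsupp.degree b ∧ ordMin a b)

/-- `Max_i`: `max(A) ≥ i` and `a_{max(A)} < b_{max(A)}` (in particular `A` is nonempty). -/
def ordMax (i : ℕ+) (a b : Mon) : Prop :=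
  ∃ j, IsGreatest (diffSet a b) j ∧ i ≤ j ∧ a j < b j

/-- `DegMax_i`. -/
def ordDegMax (i : ℕ+) (a b : Mon) : Prop :=
  Finsupp.degree a < Finsupp.degree b ∨ (Finsupp.degree a = Finsupp.degree b ∧ ordMax i a b)

/-- `RevdegMax_i`. -/
def ordRevdegMax (i : ℕ+) (a b : Mon) : Prop :=
  Finsupp.degree a > Finsupp.degree b ∨ (Finsupp.degree a = Finsupp.degree b ∧ ordMax i a b)

/-- The listed preorders (without their inverses). -/
def Listed (r : Mon → Mon → Prop) : Prop :=
  r = ordDeg ∨ r = ordMin ∨ r = ordDegMin ∨ r = ordRevdegMin ∨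
    (∃ i : ℕ+, r = ordMax i) ∨ (∃ i : ℕ+, r = ordDegMax i) ∨ (∃ i : ℕ+, r = ordRevdegMax i)

end IncOrders

/-! Modulo incomparability, the monomials form a linearly ordered cancellative monoid, which embeds
in a linearly ordered abelian group. A monomial preorder is therefore a comparison of values `φ a <
φ b`, determined by the weights `e j` of the variables (`exists_hom`, `value_single_eq`).

Compatibility becomes `ShiftStable`: a positive integer combination of up to three weights stays
positive when the gaps between the indices widen. Since adding one increasing triple of indices to
another is symmetric, a fixed combination cannot be positive at one triple and negative at another
(`nonneg_of_pos`). So every combination has a constant weak sign, and each such sign is a dichotomy: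
first differences make `e` monotone or antitone (antitone sequences pass to inverses), and second
differences make a nonconstant monotone `e` convex or concave. Iterating a weak inequality and using
constancy of sign again upgrades it to domination by every integer multiple, giving `Steep` or
`Flat` (`steep_or_flat`). Comparing `e j` with `2 • e i` in the same way decides whether the weights
dominate one another or are all infinitesimally close relative to their size.

In the first case the leading exponent difference decides, giving Max or Min. In the second the
degree decides first and the infinitesimal corrections break ties. Constant weights give Deg. The
term orders are then filtered from the list by requiring comparability of distinct monomials and `1`
as least element. -/

namespace IncOrders

set_option linter.unusedSectionVars false

/-! ### Embedding a monomial preorder in a linearly ordered group -/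

section

variable {r : Mon → Mon → Prop}

namespace IsMonomialPreorder

theorem add_iff (hr : IsMonomialPreorder r) (f g h : Mon) : r (h + f) (h + g) ↔ r f g :=
  ⟨hr.cancel f g h, hr.mul f g h⟩

theorem incomparable_add_iff (hr : IsMonomialPreorder r) (f g h : Mon) :
    Incomparable r (h + f) (h + g) ↔ Incomparable r f g := by
  simp only [Incomparable, hr.add_iff]

theorem asymm (hr : IsMonomialPreorder r) {f g : Mon} (h : r f g) : ¬ r g f :=
  fun h' => hr.irrefl f (hr.trans f g f h h')

/-- This is transitivity of the weak order on incomparability classes; it is where transitivity of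
incomparability is needed. -/
theorem not_trans (hr : IsMonomialPreorder r) {f g h : Mon} (h₁ : ¬ r g f) (h₂ : ¬ r h g) :
    ¬ r h f := by
  intro h₃
  by_cases h₄ : r f g
  · exact h₂ (hr.trans _ _ _ h₃ h₄)
  · by_cases h₅ : r g h
    · exact h₁ (hr.trans _ _ _ h₅ h₃)
    · exact (hr.incomparable_trans f g h ⟨h₄, h₁⟩ ⟨h₅, h₂⟩).2 h₃

/-- Incomparability with respect to a monomial preorder, as an additive congruence. -/
def con (hr : IsMonomialPreorder r) : AddCon Mon where
  r := Incomparable r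
  iseqv := ⟨fun f => ⟨hr.irrefl f, hr.irrefl f⟩, fun h => ⟨h.2, h.1⟩,
    fun h₁ h₂ => hr.incomparable_trans _ _ _ h₁ h₂⟩
  add' := by
    intro w x y z h₁ h₂
    have h₃ := (hr.incomparable_add_iff _ _ w).2 h₂
    have h₄ := (hr.incomparable_add_iff _ _ z).2 h₁
    rw [add_comm z, add_comm z] at h₄
    exact hr.incomparable_trans _ _ _ h₃ h₄

theorem con_iff (hr : IsMonomialPreorder r) {f g : Mon} :
    (f : hr.con.Quotient) = g ↔ Incomparable r f g := hr.con.eq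

/-- The linear order that a monomial preorder induces on incomparability classes. -/
noncomputable instance quotientLinearOrder (hr : IsMonomialPreorder r) :
    LinearOrder hr.con.Quotient where
  le := Quotient.lift₂ (fun f g => ¬ r g f) (by
    rintro a b c d ⟨h₁, h₂⟩ ⟨h₃, h₄⟩
    exact propext ⟨fun h => hr.not_trans h₁ (hr.not_trans h h₄),
      fun h => hr.not_trans h₂ (hr.not_trans h h₃)⟩)
  le_refl := by rintro ⟨f⟩; exact hr.irrefl f
  le_trans := by rintro ⟨f⟩ ⟨g⟩ ⟨h⟩ h₁ h₂; exact hr.not_trans h₁ h₂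
  le_antisymm := by rintro ⟨f⟩ ⟨g⟩ h₁ h₂; exact hr.con_iff.2 ⟨h₂, h₁⟩
  le_total := by
    rintro ⟨f⟩ ⟨g⟩
    exact or_iff_not_imp_left.2 fun h => hr.asymm (not_not.1 h)
  toDecidableLE := Classical.decRel _

theorem coe_le_coe (hr : IsMonomialPreorder r) {f g : Mon} :
    (f : hr.con.Quotient) ≤ g ↔ ¬ r g f := Iff.rfl

instance (hr : IsMonomialPreorder r) : IsOrderedCancelAddMonoid hr.con.Quotient where
  add_le_add_left := by
    rintro ⟨f⟩ ⟨g⟩ h ⟨k⟩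
    change ¬ r (g + k) (f + k)
    rw [add_comm g, add_comm f, hr.add_iff]
    exact h
  le_of_add_le_add_left := by
    rintro ⟨k⟩ ⟨f⟩ ⟨g⟩ h
    exact fun h' => h (hr.mul _ _ k h')

/-- Monomial preorders are pulled back from linearly ordered groups. -/
theorem exists_hom (hr : IsMonomialPreorder r) :
    ∃ (G : Type) (_ : AddCommGroup G) (_ : LinearOrder G) (_ : IsOrderedAddMonoid G)
      (φ : Mon →+ G), ∀ a b, r a b ↔ φ a < φ b := by
  refine ⟨Algebra.GrothendieckAddGroup hr.con.Quotient, inferInstance, inferInstance,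
    { add_le_add_left := fun a b h c => ?_ }, Algebra.GrothendieckAddGroup.of.comp hr.con.mk', fun a b => ?_⟩
  · exact add_le_add_left h c
  -- Cancellativity of the quotient makes the map to its group of differences an order embedding, so
  -- no strict inequality is lost.
  · have h := (AddLocalization.mkOrderEmbedding (0 : (⊤ : AddSubmonoid hr.con.Quotient))).lt_iff_lt
      (a := (a : hr.con.Quotient)) (b := b)
    rw [← not_le (a := (b : hr.con.Quotient)), hr.coe_le_coe, not_not] at h
    exact h.symm

end IsMonomialPreorder

end

/-! ### Sign rigidity and growth of the weight sequence -/

section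

variable {G : Type*} [AddCommGroup G] [LinearOrder G] [IsOrderedAddMonoid G] {e : ℕ+ → G}

/-- Positivity of integer combinations of three terms of `e` survives widening the gaps between
their indices. -/
def ShiftStable (e : ℕ+ → G) : Prop :=
  ∀ (a b c : ℤ) (i j k i' j' k' : ℕ+), i < j → j < k → i' ≤ j' → j' ≤ k' →
    0 < a • e i + b • e j + c • e k → 0 < a • e (i + i') + b • e (j + j') + c • e (k + k')

namespace ShiftStable

theorem neg (h : ShiftStable e) : ShiftStable (-e) := by
  intro a b c i j k i' j' k' hij hjk hij' hjk' hpos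
  have := h (-a) (-b) (-c) i j k i' j' k' hij hjk hij' hjk'
  simp only [Pi.neg_apply, smul_neg, neg_smul] at *
  exact this hpos

/-- Shifting `(i, j, k)` by `(i', j', k')` and shifting the second triple by the first lead to the
same indices. Opposite strict signs at the two triples would both be inherited there. -/
theorem nonneg_of_pos (h : ShiftStable e) (a b c : ℤ) {i j k i' j' k' : ℕ+}
    (hij : i < j) (hjk : j < k) (hij' : i' < j') (hjk' : j' < k')
    (hpos : 0 < a • e i + b • e j + c • e k) : 0 ≤ a • e i' + b • e j' + c • e k' := by
  by_contra! hneg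
  have h₁ := h a b c i j k i' j' k' hij hjk hij'.le hjk'.le hpos
  have h₂ := h (-a) (-b) (-c) i' j' k' i j k hij' hjk' hij.le hjk.le (by
    rw [← neg_pos] at hneg
    convert hneg using 1
    module)
  simp only [add_comm i', add_comm j', add_comm k', neg_smul] at h₂
  rw [← neg_add, ← neg_add, neg_pos] at h₂
  exact lt_asymm h₁ h₂

theorem pair_nonneg_of_pos (h : ShiftStable e) (a b : ℤ) {i j i' j' : ℕ+}
    (hij : i < j) (hij' : i' < j') (hpos : 0 < a • e i + b • e j) :
    0 ≤ a • e i' + b • e j' := by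
  simpa using h.nonneg_of_pos a b 0 hij (PNat.lt_add_right j 1) hij' (PNat.lt_add_right j' 1)
    (by simpa using hpos)

theorem pair_shift (h : ShiftStable e) (a b : ℤ) {i j : ℕ+} (hij : i < j) (t : ℕ+)
    (hpos : 0 < a • e i + b • e j) : 0 < a • e (i + t) + b • e (j + t) := by
  simpa using h a b 0 i j (j + 1) t t t hij (PNat.lt_add_right j 1) le_rfl le_rfl
    (by simpa using hpos)

/-- Every integer combination of two terms has a constant weak sign. -/
theorem pair_nonneg_or_nonpos (h : ShiftStable e) (a b : ℤ) :
    (∀ i j, i < j → 0 ≤ a • e i + b • e j) ∨ (∀ i j, i < j → a • e i + b • e j ≤ 0) := by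
  by_contra! hc
  obtain ⟨⟨i, j, hij, hneg⟩, i', j', hij', hpos⟩ := hc
  exact absurd (h.pair_nonneg_of_pos a b hij' hij hpos) hneg.not_ge

/-- Every integer combination of three terms has a constant weak sign. -/
theorem triple_nonneg_or_nonpos (h : ShiftStable e) (a b c : ℤ) :
    (∀ i j k, i < j → j < k → 0 ≤ a • e i + b • e j + c • e k) ∨
      (∀ i j k, i < j → j < k → a • e i + b • e j + c • e k ≤ 0) := by
  by_contra! hc
  obtain ⟨⟨i, j, k, hij, hjk, hneg⟩, i', j', k', hij', hjk', hpos⟩ := hc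
  exact absurd (h.nonneg_of_pos a b c hij' hjk' hij hjk hpos) hneg.not_ge

theorem nonneg_or_nonpos (h : ShiftStable e) : (∀ j, 0 ≤ e j) ∨ (∀ j, e j ≤ 0) := by
  refine (h.pair_nonneg_or_nonpos 1 0).imp (fun H j => ?_) (fun H j => ?_)
  · simpa using H j (j + 1) (PNat.lt_add_right j 1)
  · simpa using H j (j + 1) (PNat.lt_add_right j 1)

theorem monotone_or_antitone (h : ShiftStable e) : Monotone e ∨ Antitone e := by
  refine (h.pair_nonneg_or_nonpos (-1) 1).imp (fun H i j hij => ?_) (fun H i j hij => ?_)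
  · rcases hij.eq_or_lt with rfl | hij
    · rfl
    · have := H i j hij
      simp only [neg_smul, one_smul] at this
      grind
  · rcases hij.eq_or_lt with rfl | hij
    · rfl
    · have := H i j hij
      simp only [neg_smul, one_smul] at this
      grind

/-- A monotone shift stable sequence that is not constant is not eventually constant. -/
theorem exists_lt_of_ne (h : ShiftStable e) (hm : Monotone e) (hne : ∃ i, e i ≠ e 1) (N : ℕ+) :
    ∃ i j, N < i ∧ i < j ∧ e i < e j := by
  obtain ⟨j, hj⟩ := hne
  have h1j : 1 < j := lt_of_le_of_ne (show 1 ≤ j from one_le) (by rintro rfl; exact hj rfl)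
  have hlt : e 1 < e j := lt_of_le_of_ne (hm h1j.le) hj.symm
  -- Constancy of sign is only weak; strictness has to be transported by translating past `N`.
  have := h.pair_shift (-1) 1 h1j N (by simpa using hlt)
  refine ⟨1 + N, j + N, by rw [add_comm]; exact PNat.lt_add_right N 1, by simpa using h1j, ?_⟩
  simpa using this

end ShiftStable

/-- Later differences dominate earlier ones. -/
def Steep (e : ℕ+ → G) : Prop :=
  ∀ (n : ℕ) (i j k : ℕ+), i < j → j < k → n • (e j - e i) ≤ e k - e j

/-- Earlier differences dominate later ones. -/
def Flat (e : ℕ+ → G) : Prop :=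
  ∀ (n : ℕ) (i j k : ℕ+), i < j → j < k → n • (e k - e j) ≤ e j - e i


/-- Each further step contributes a difference at least as large as `e j - e i`, so the steps add
up. -/
theorem exists_nsmul_le_of_convex (hm : Monotone e)
    (hcv : ∀ i j k, i < j → j < k → e j - e i ≤ e k - e j) {i j : ℕ+} (hij : i < j) (n : ℕ) :
    ∃ k, j < k ∧ n • (e j - e i) ≤ e k - e j := by
  induction n with
  | zero => exact ⟨j + 1, PNat.lt_add_right j 1, by
      simpa using hm (PNat.lt_add_right j 1).le⟩
  | succ n ih =>
    obtain ⟨k, hk, hle⟩ := ih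
    have h₁ := hcv i j k hij hk
    have h₂ := hcv j k (k + 1) hk (PNat.lt_add_right k 1)
    refine ⟨k + 1, hk.trans (PNat.lt_add_right k 1), ?_⟩
    rw [succ_nsmul]
    calc n • (e j - e i) + (e j - e i) ≤ (e k - e j) + (e (k + 1) - e k) :=
          add_le_add hle (h₁.trans h₂)
      _ = e (k + 1) - e j := by abel

/-- Moving `j` one step on adds to `e j - e i` a gap that already dominates everything after it. -/
theorem exists_nsmul_le_of_concave (hm : Monotone e)
    (hcv : ∀ i j k, i < j → j < k → e k - e j ≤ e j - e i) (i : ℕ+) (n : ℕ) :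
    ∃ j, i < j ∧ ∀ k, j < k → n • (e k - e j) ≤ e j - e i := by
  induction n with
  | zero => exact ⟨i + 1, PNat.lt_add_right i 1, fun k _ => by
      simpa using hm (PNat.lt_add_right i 1).le⟩
  | succ n ih =>
    obtain ⟨j, hj, hle⟩ := ih
    refine ⟨j + 1, hj.trans (PNat.lt_add_right j 1), fun k hk => ?_⟩
    have h₁ := hcv j (j + 1) k (PNat.lt_add_right j 1) hk
    have h₂ := hle k ((PNat.lt_add_right j 1).trans hk)
    have h₃ : e k - e (j + 1) ≤ e k - e j := sub_le_sub_left (hm (PNat.lt_add_right j 1).le) _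
    rw [succ_nsmul]
    calc n • (e k - e (j + 1)) + (e k - e (j + 1))
        ≤ (e j - e i) + (e (j + 1) - e j) :=
          add_le_add ((nsmul_le_nsmul_right h₃ n).trans h₂) h₁
      _ = e (j + 1) - e i := by abel

/-- The second difference chooses the alternative. For each `n` the required inequality is again the
sign of one combination, so a single triple where the opposite sign fails suffices; convexity or
concavity supplies it. -/
theorem ShiftStable.steep_or_flat (h : ShiftStable e) (hm : Monotone e)
    (hne : ∃ i, e i ≠ e 1) : Steep e ∨ Flat e := by
  refine (h.triple_nonneg_or_nonpos 1 (-2) 1).imp (fun H => ?_) (fun H => ?_)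
  · have hcv : ∀ i j k, i < j → j < k → e j - e i ≤ e k - e j := fun i j k hij hjk => by
      rw [← sub_nonneg]
      convert H i j k hij hjk using 1
      module
    intro n
    rcases h.triple_nonneg_or_nonpos n (-(n + 1)) 1 with H' | H'
    · intro i j k hij hjk
      rw [← sub_nonneg]
      convert H' i j k hij hjk using 1
      module
    · exfalso
      obtain ⟨i, j, -, hij, hlt⟩ := h.exists_lt_of_ne hm hne 1
      -- The opposite sign bounds `e k - e j` by `n` copies of `e j - e i`; with `n + 1` copies
      -- below it, one copy would be nonpositive.
      obtain ⟨k, hk, hle⟩ := exists_nsmul_le_of_convex hm hcv hij (n + 1)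
      have h₁ := H' i j k hij hk
      rw [← sub_nonneg] at hle
      have h₂ := add_le_add (neg_nonneg.2 h₁) hle
      refine (sub_pos.2 hlt).not_ge ?_
      rw [← sub_nonneg]
      convert h₂ using 1 <;> module
  · have hcv : ∀ i j k, i < j → j < k → e k - e j ≤ e j - e i := fun i j k hij hjk => by
      rw [← sub_nonpos]
      convert H i j k hij hjk using 1
      module
    intro n
    rcases h.triple_nonneg_or_nonpos (-1) (n + 1) (-n) with H' | H'
    · intro i j k hij hjk
      rw [← sub_nonneg]
      convert H' i j k hij hjk using 1
      module
    · exfalso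
      -- Here `j` must come first: its bound holds for all later `k`, so `k` can then be taken where
      -- `e` has strictly grown.
      obtain ⟨j, hj, hle⟩ := exists_nsmul_le_of_concave hm hcv 1 (n + 1)
      obtain ⟨i, k, hji, hik, hlt⟩ := h.exists_lt_of_ne hm hne j
      have hjk := hji.trans hik
      have h₁ := H' 1 j k hj hjk
      have h₃ := hle k hjk
      rw [← sub_nonneg] at h₃
      have h₂ := add_le_add (neg_nonneg.2 h₁) h₃
      refine (sub_pos.2 ((hm hji.le).trans_lt hlt)).not_ge ?_
      rw [← sub_nonneg]
      convert h₂ using 1 <;> module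

/-- The steep nonpositive sequences: differences are dominated by the degree. -/
theorem Steep.nsmul_sub_le_neg (hs : Steep e) (hm : Monotone e) (hneg : ∀ j, e j ≤ 0)
    (n : ℕ) (k : ℕ+) : n • (e k - e 1) ≤ -e 1 := by
  have hk1 := hm (show 1 ≤ k from one_le)
  rcases (show 1 ≤ k from one_le).eq_or_lt with rfl | hk
  · simpa using hneg 1
  -- The bound closes since `e (k + 1) - e k ≤ -e k ≤ -e 1`.
  · have h₁ := hs n 1 k (k + 1) hk (PNat.lt_add_right k 1)
    have h₂ := hneg (k + 1)
    grind

/-- The sign of `e j - 2 • e i` decides. Doubling at each step compounds to domination by all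
multiples. Otherwise all weights stay below `2 • e 1`, and the next difference, which dominates `e k
- e 1`, is at most `e 1`. -/
theorem ShiftStable.steep_nonneg (h : ShiftStable e) (hm : Monotone e) (hne : ∃ i, e i ≠ e 1)
    (hs : Steep e) (hpos : ∀ j, 0 ≤ e j) :
    (∀ (n : ℕ) (j k : ℕ+), j < k → n • e j ≤ e k) ∨
      (∀ (n : ℕ) (k : ℕ+), n • (e k - e 1) ≤ e 1) := by
  refine (h.pair_nonneg_or_nonpos (-2) 1).imp (fun H => ?_) (fun H => ?_)
  · have hdouble : ∀ i j, i < j → e i + e i ≤ e j := fun i j hij => by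
      rw [← sub_nonneg]
      convert H i j hij using 1
      module
    have hgrow : ∀ (n : ℕ) (i : ℕ+), ∃ j, i < j ∧ n • e i ≤ e j := by
      intro n i
      induction n with
      | zero => exact ⟨i + 1, PNat.lt_add_right i 1, by simpa using hpos _⟩
      | succ n ih =>
        obtain ⟨j, hj, hle⟩ := ih
        refine ⟨j + 1, hj.trans (PNat.lt_add_right j 1), ?_⟩
        rw [succ_nsmul]
        exact (add_le_add hle (hm hj.le)).trans (hdouble _ _ (PNat.lt_add_right j 1))
    intro n
    rcases h.pair_nonneg_or_nonpos (-n) 1 with H' | H'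
    · intro j k hjk
      rw [← sub_nonneg]
      convert H' j k hjk using 1
      module
    · exfalso
      obtain ⟨i, j, -, hij, hlt⟩ := h.exists_lt_of_ne hm hne 1
      obtain ⟨k, hk, hle⟩ := hgrow (n + 1) j
      have h₁ := H' j k hk
      rw [← sub_nonneg] at hle
      have h₂ := add_le_add (neg_nonneg.2 h₁) hle
      refine ((hpos i).trans_lt hlt).not_ge ?_
      rw [← sub_nonneg]
      convert h₂ using 1 <;> module
  · have hdouble : ∀ i j, i < j → e j ≤ e i + e i := fun i j hij => by
      rw [← sub_nonpos]
      convert H i j hij using 1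
      module
    intro n k
    rcases (show 1 ≤ k from one_le).eq_or_lt with rfl | hk
    · simpa using hpos 1
    · have h₁ := hs n 1 k (k + 1) hk (PNat.lt_add_right k 1)
      have h₂ := hdouble 1 (k + 1) (hk.trans (PNat.lt_add_right k 1))
      have h₃ := hm hk.le
      grind

/-- If `d` controls multiples of differences past the first index, it does so from the start. -/
theorem ShiftStable.nsmul_sub_le (h : ShiftStable e) (hm : Monotone e) (hne : ∃ i, e i ≠ e 1)
    (ε : ℤ) (H : ∀ (n : ℕ) (j k : ℕ+), 1 < j → j < k → n • (e k - e j) ≤ ε • e j)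
    (n : ℕ) {j k : ℕ+} (hjk : j < k) : n • (e k - e j) ≤ ε • e j := by
  -- The claim is a sign of one pair combination, so the opposite sign can be refuted at a pair past
  -- index 1, using `H` at `n + 1`.
  rcases h.pair_nonneg_or_nonpos (n + ε) (-n) with H' | H'
  · rw [← sub_nonneg]
    convert H' j k hjk using 1
    module
  · exfalso
    obtain ⟨i, k, hi, hik, hlt⟩ := h.exists_lt_of_ne hm hne 1
    have h₁ := H' i k hik
    have h₃ := H (n + 1) i k hi hik
    rw [← sub_nonneg] at h₃
    have h₂ := add_le_add (neg_nonneg.2 h₁) h₃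
    refine (sub_pos.2 hlt).not_ge ?_
    rw [← sub_nonneg]
    convert h₂ using 1 <;> module

/-- For `1 < j`, flatness bounds the multiples by `e j - e 1 ≤ e j`; `nsmul_sub_le` then covers `j =
1`, which has no earlier index. -/
theorem ShiftStable.flat_nonneg (h : ShiftStable e) (hm : Monotone e) (hne : ∃ i, e i ≠ e 1)
    (hs : Flat e) (hpos : ∀ j, 0 ≤ e j) (n : ℕ) {j k : ℕ+} (hjk : j < k) :
    n • (e k - e j) ≤ e j := by
  have := h.nsmul_sub_le hm hne 1 (fun n j k hj hjk => ?_) n hjk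
  · simpa using this
  · have h₁ := hs n 1 j k hj hjk
    have h₂ := hpos 1
    rw [one_smul]
    grind

/-- The positive weights `-e j` decrease. If each is at least twice any later one, halving compounds
to domination; if not, `e j - e 1 ≤ -e j`, and flatness puts all multiples of later differences
below this. -/
theorem ShiftStable.flat_nonpos (h : ShiftStable e) (hm : Monotone e) (hne : ∃ i, e i ≠ e 1)
    (hs : Flat e) (hneg : ∀ j, e j ≤ 0) :
    (∀ (n : ℕ) (j k : ℕ+), j < k → n • (-e k) ≤ -e j) ∨
      (∀ (n : ℕ) (j k : ℕ+), j < k → n • (e k - e j) ≤ -e j) := by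
  refine (h.pair_nonneg_or_nonpos (-1) 2).imp (fun H => ?_) (fun H => ?_)
  · have hdouble : ∀ i j, i < j → -e j + -e j ≤ -e i := fun i j hij => by
      rw [← sub_nonneg]
      convert H i j hij using 1
      module
    have hgrow : ∀ (n : ℕ), ∃ j, 1 < j ∧ (n + 1) • (-e j) ≤ -e 1 := by
      intro n
      induction n with
      | zero => exact ⟨1 + 1, PNat.lt_add_right 1 1, by
          simpa using hm (PNat.lt_add_right 1 1).le⟩
      | succ n ih =>
        obtain ⟨j, hj, hle⟩ := ih
        refine ⟨j + 1, hj.trans (PNat.lt_add_right j 1), ?_⟩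
        have h₁ := nsmul_le_nsmul_right (hdouble _ _ (PNat.lt_add_right j 1)) (n + 1)
        refine le_trans ?_ (h₁.trans hle)
        rw [← two_nsmul, ← mul_nsmul']
        exact nsmul_le_nsmul_left (neg_nonneg.2 (hneg _)) (by lia)
    intro n
    rcases h.pair_nonneg_or_nonpos (-1) n with H' | H'
    · intro j k hjk
      rw [← sub_nonneg]
      convert H' j k hjk using 1
      module
    · exfalso
      obtain ⟨j, hj, hle⟩ := hgrow n
      obtain ⟨i, k, hji, hik, hlt⟩ := h.exists_lt_of_ne hm hne j
      have h₁ := H' 1 j hj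
      rw [← sub_nonneg] at hle
      have h₂ := add_le_add (neg_nonneg.2 h₁) hle
      refine (((hm hji.le).trans_lt hlt).trans_le (hneg k)).not_ge ?_
      rw [← sub_nonneg]
      convert h₂ using 1 <;> module
  · have hdouble : ∀ i j, i < j → -e i ≤ -e j + -e j := fun i j hij => by
      rw [← sub_nonpos]
      convert H i j hij using 1
      module
    intro n j k hjk
    have := h.nsmul_sub_le hm hne (-1) (fun n j k hj hjk => ?_) n hjk
    · simpa using this
    · have h₁ := hs n 1 j k hj hjk
      have h₂ := hdouble 1 j hj
      rw [neg_one_smul]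
      grind

end

/-! ### Comparing monomials by leading exponents and infinitesimal corrections -/

section

theorem diffSet_finite (a b : Mon) : (diffSet a b).Finite :=
  (a.support ∪ b.support).finite_toSet.subset fun j hj => by
    by_contra h
    simp only [Finset.coe_union, Set.mem_union, Finset.mem_coe, Finsupp.mem_support_iff,
      not_or, not_not] at h
    exact hj (h.1.trans h.2.symm)

theorem diffSet_comm (a b : Mon) : diffSet a b = diffSet b a := by
  ext j
  exact ne_comm

theorem exists_isGreatest_diffSet {a b : Mon} (h : a ≠ b) : ∃ k, IsGreatest (diffSet a b) k := by
  obtain ⟨j, hj⟩ := Finsupp.ne_iff.1 h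
  obtain ⟨k, hk, hmax⟩ := Set.exists_max_image (diffSet a b) id (diffSet_finite a b) ⟨j, hj⟩
  exact ⟨k, hk, hmax⟩

theorem exists_isLeast_diffSet {a b : Mon} (h : a ≠ b) : ∃ k, IsLeast (diffSet a b) k := by
  obtain ⟨j, hj⟩ := Finsupp.ne_iff.1 h
  obtain ⟨k, hk, hmin⟩ := Set.exists_min_image (diffSet a b) id (diffSet_finite a b) ⟨j, hj⟩
  exact ⟨k, hk, hmin⟩

theorem ordMin_or_ordMin {a b : Mon} (h : a ≠ b) : ordMin a b ∨ ordMin b a := by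
  obtain ⟨k, hk⟩ := exists_isLeast_diffSet h
  rcases lt_or_gt_of_ne hk.1 with hlt | hlt
  · exact Or.inl ⟨k, hk, hlt⟩
  · exact Or.inr ⟨k, diffSet_comm a b ▸ hk, hlt⟩

theorem ordMax_or_ordMax {i j : ℕ+} (hij : i ≤ j) {a b : Mon} (h : a j ≠ b j) :
    ordMax i a b ∨ ordMax i b a := by
  obtain ⟨k, hk⟩ := exists_isGreatest_diffSet (a := a) (b := b) (fun hab => h (by rw [hab]))
  have hik : i ≤ k := hij.trans (hk.2 h)
  rcases lt_or_gt_of_ne hk.1 with hlt | hlt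
  · exact Or.inl ⟨k, hk, hik, hlt⟩
  · exact Or.inr ⟨k, diffSet_comm a b ▸ hk, hik, hlt⟩

variable {G : Type*} [AddCommGroup G] [LinearOrder G] [IsOrderedAddMonoid G] {e u : ℕ+ → G}

/-- The elements all of whose multiples are bounded by `|y|`. -/
def infinitesimals (y : G) : AddSubgroup G where
  carrier := {x | ∀ n : ℤ, n • x ≤ |y|}
  zero_mem' := fun n => by simp
  add_mem' := fun {x x'} hx hx' n => by
    -- The two bounds add up to `2 • |y|`; doubling the multiplier allows the factor 2 to be
    -- cancelled.
    have h := add_le_add (hx (2 * n)) (hx' (2 * n))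
    have h' : (2 : ℕ) • (n • (x + x')) ≤ 2 • |y| := by
      convert h using 1 <;> module
    exact le_of_nsmul_le_nsmul_right two_ne_zero h'
  neg_mem' := fun {x} hx n => by
    have := hx (-n)
    rwa [neg_smul, ← smul_neg] at this

theorem mem_infinitesimals {x y : G} : x ∈ infinitesimals y ↔ ∀ n : ℤ, n • x ≤ |y| := Iff.rfl

theorem mem_infinitesimals_of_nonneg {x y : G} (hx : 0 ≤ x) (h : ∀ n : ℕ, n • x ≤ |y|) :
    x ∈ infinitesimals y := by
  rintro (n | n)
  · simpa using h n
  · refine le_trans ?_ (abs_nonneg y)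
    rw [negSucc_zsmul, neg_nonpos]
    exact nsmul_nonneg hx _

theorem infinitesimals_neg (y : G) : infinitesimals (-y) = infinitesimals y := by
  ext x
  simp [mem_infinitesimals]

theorem zsmul_add_pos {x y : G} (hy : 0 < y) (hx : x ∈ infinitesimals y) {c : ℤ} (hc : 0 < c) :
    0 < c • y + x := by
  -- This gives `0 ≤ y + 2x`, hence `2(y + x) ≥ y > 0`.
  have h₁ := hx (-2)
  rw [abs_of_pos hy] at h₁
  have h₂ : (1 : ℤ) • y ≤ c • y := zsmul_le_zsmul_left hy.le hc
  grind

theorem zsmul_add_pos_iff {x y : G} (hy : 0 < y) (hx : x ∈ infinitesimals y) (d : ℤ) :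
    0 < d • y + x ↔ 0 < d ∨ d = 0 ∧ 0 < x := by
  rcases lt_trichotomy d 0 with hd | rfl | hd
  · have := zsmul_add_pos hy (neg_mem hx) (neg_pos.2 hd)
    rw [neg_smul, ← neg_add, neg_pos] at this
    simp [this.not_gt, hd.not_gt, hd.ne]
  · simp
  · simp [zsmul_add_pos hy hx hd, hd]

/-- The value of a monomial whose variables have values `e`. -/
noncomputable def value (e : ℕ+ → G) (a : Mon) : G := a.sum fun j n => n • e j

theorem value_eq_sum (e : ℕ+ → G) {a : Mon} {s : Finset ℕ+} (hs : a.support ⊆ s) :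
    value e a = ∑ j ∈ s, (a j : ℤ) • e j := by
  simp only [natCast_zsmul]
  exact Finsupp.sum_of_support_subset _ hs _ (by simp)

theorem value_sub_value (e : ℕ+ → G) {a b : Mon} {s : Finset ℕ+} (ha : a.support ⊆ s)
    (hb : b.support ⊆ s) : value e b - value e a = ∑ j ∈ s, ((b j : ℤ) - a j) • e j := by
  rw [value_eq_sum e ha, value_eq_sum e hb, ← Finset.sum_sub_distrib]
  simp only [sub_smul]

theorem value_neg (e : ℕ+ → G) (a : Mon) : value (-e) a = -value e a := by
  simp [value, Finsupp.sum]

/-- When all `e j - y` are infinitesimal relative to `y`, the first summand decides unless the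
degrees agree. -/
theorem value_eq_degree_add (e : ℕ+ → G) (y : G) (a : Mon) :
    value e a = ((Finsupp.degree a : ℕ) : ℤ) • y + value (fun j => e j - y) a := by
  simp only [value, Finsupp.sum, Finsupp.degree_apply, natCast_zsmul, Finset.sum_smul,
    ← Finset.sum_add_distrib]
  exact Finset.sum_congr rfl fun j _ => by rw [smul_sub]; abel

/-- A sum is positive if its leading term is. -/
theorem sum_pos_of_leading {s : Finset ℕ+} {c : ℕ+ → ℤ} {k : ℕ+} (hk : k ∈ s) (hc : 0 < c k)
    (hu : 0 < u k) (h : ∀ j ∈ s, j ≠ k → c j ≠ 0 → u j ∈ infinitesimals (u k)) :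
    0 < ∑ j ∈ s, c j • u j := by
  rw [← Finset.add_sum_erase _ _ hk]
  refine zsmul_add_pos hu (sum_mem fun j hj => ?_) hc
  rw [Finset.mem_erase] at hj
  by_cases hj0 : c j = 0
  · simp [hj0]
  · exact zsmul_mem (h j hj.2 hj.1 hj0) _

theorem value_lt_value_of_leading {a b : Mon} {k : ℕ+} (hab : a k < b k) (hu : 0 < u k)
    (h : ∀ j ∈ diffSet a b, j ≠ k → u j ∈ infinitesimals (u k)) : value u a < value u b := by
  rw [← sub_pos, value_sub_value u Finset.subset_union_left Finset.subset_union_right]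
  refine sum_pos_of_leading (k := k) ?_ (by lia) hu fun j _ hjk hc => h j ?_ hjk
  · rw [Finset.mem_union, Finsupp.mem_support_iff, Finsupp.mem_support_iff]
    lia
  · intro heq
    exact hc (by rw [heq, sub_self])

/-- The index is the first with nonzero weight: earlier variables are invisible, and from there on
each weight is positive and dominates all earlier ones. -/
theorem exists_value_lt_iff_ordMax (h0 : ∀ j, 0 ≤ u j)
    (hu : ∀ (n : ℕ) (j k : ℕ+), j < k → n • u j ≤ u k) (hne : ∃ i, u i ≠ 0) :
    ∃ i, (fun a b => value u a < value u b) = ordMax i := by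
  obtain ⟨i, hi, hmin⟩ := WellFounded.has_min (wellFounded_lt (α := ℕ+)) {i | u i ≠ 0} hne
  have key : ∀ a b, ordMax i a b → value u a < value u b := by
    rintro a b ⟨k, hk, hik, hlt⟩
    have hpos : 0 < u k := by
      rcases hik.eq_or_lt with rfl | hik
      · exact lt_of_le_of_ne (h0 _) (Ne.symm hi)
      · have := hu 1 i k hik
        rw [one_smul] at this
        exact (lt_of_le_of_ne (h0 _) (Ne.symm hi)).trans_le this
    refine value_lt_value_of_leading hlt hpos fun j hj hjk => ?_
    refine mem_infinitesimals_of_nonneg (h0 j) fun n => ?_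
    rw [abs_of_pos hpos]
    exact hu n j k (lt_of_le_of_ne (hk.2 hj) hjk)
  refine ⟨i, ?_⟩
  ext a b
  refine ⟨fun hlt => ?_, key a b⟩
  by_contra hno
  have hno' : ¬ ordMax i b a := fun h' => lt_asymm hlt (key b a h')
  refine hlt.ne ?_
  rw [← sub_eq_zero, value_sub_value u Finset.subset_union_right Finset.subset_union_left]
  refine Finset.sum_eq_zero fun j _ => ?_
  rcases lt_or_ge j i with hj | hj
  · rw [not_not.1 fun h' => hmin j h' hj, smul_zero]
  · have : a j = b j := by
      by_contra hab
      exact (ordMax_or_ordMax hj hab).elim hno hno'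
    rw [this, sub_self, zero_smul]

/-- The cutoff `L` allows weights such as `e L - e j`, which are positive only below `L`. -/
theorem value_lt_iff_ordMin {L : ℕ+} (h0 : ∀ j < L, 0 < u j)
    (hu : ∀ (n : ℕ) (j k : ℕ+), j < k → k < L → n • u k ≤ u j) {a b : Mon}
    (ha : ∀ j ∈ a.support, j < L) (hb : ∀ j ∈ b.support, j < L) :
    value u a < value u b ↔ ordMin a b := by
  have hsub : ∀ {a b : Mon}, (∀ j ∈ a.support, j < L) → (∀ j ∈ b.support, j < L) →
      ∀ j ∈ diffSet a b, j < L := by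
    intro a b ha hb j hj
    by_cases haj : j ∈ a.support
    · exact ha j haj
    · refine hb j (Finsupp.mem_support_iff.2 fun hbj => hj ?_)
      rw [Finsupp.notMem_support_iff.1 haj, hbj]
  have key : ∀ {a b : Mon}, (∀ j ∈ a.support, j < L) → (∀ j ∈ b.support, j < L) →
      ordMin a b → value u a < value u b := by
    rintro a b ha hb ⟨k, hk, hlt⟩
    have hpos := h0 k (hsub ha hb k hk.1)
    refine value_lt_value_of_leading hlt hpos fun j hj hjk => ?_
    have hjL := hsub ha hb j hj
    refine mem_infinitesimals_of_nonneg (h0 j hjL).le fun n => ?_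
    rw [abs_of_pos hpos]
    exact hu n k j (lt_of_le_of_ne (hk.2 hj) hjk.symm) hjL
  refine ⟨fun hlt => ?_, key ha hb⟩
  have hab : a ≠ b := by rintro rfl; exact lt_irrefl _ hlt
  exact (ordMin_or_ordMin hab).resolve_right fun h' => lt_asymm hlt (key hb ha h')

theorem value_mem {S : AddSubgroup G} {a : Mon} (h : ∀ j ∈ a.support, u j ∈ S) :
    value u a ∈ S := sum_mem fun j hj => nsmul_mem (h j hj) _

theorem value_lt_iff_of_degree_pos {y : G} (hy : 0 < y) {a b : Mon}
    (ha : ∀ j ∈ a.support, e j - y ∈ infinitesimals y)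
    (hb : ∀ j ∈ b.support, e j - y ∈ infinitesimals y) :
    value e a < value e b ↔ Finsupp.degree a < Finsupp.degree b ∨
      (Finsupp.degree a = Finsupp.degree b ∧
        value (fun j => e j - y) a < value (fun j => e j - y) b) := by
  have hx : value (fun j => e j - y) b - value (fun j => e j - y) a ∈ infinitesimals y :=
    sub_mem (value_mem hb) (value_mem ha)
  have := zsmul_add_pos_iff hy hx (((Finsupp.degree b : ℕ) : ℤ) - ((Finsupp.degree a : ℕ) : ℤ))
  rw [sub_pos, sub_eq_zero, sub_pos] at this
  rw [← sub_pos, value_eq_degree_add e y a, value_eq_degree_add e y b]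
  rw [show ∀ p q s t : G, p + q - (s + t) = (p - s) + (q - t) by intros; abel, ← sub_smul, this]
  norm_cast
  rw [eq_comm (a := Finsupp.degree a)]

theorem value_lt_iff_of_degree_neg {y : G} (hy : y < 0) {a b : Mon}
    (ha : ∀ j ∈ a.support, e j - y ∈ infinitesimals y)
    (hb : ∀ j ∈ b.support, e j - y ∈ infinitesimals y) :
    value e a < value e b ↔ Finsupp.degree a > Finsupp.degree b ∨
      (Finsupp.degree a = Finsupp.degree b ∧
        value (fun j => e j - y) a < value (fun j => e j - y) b) := by
  have hfun : (fun j => (-e) j - -y) = -fun j => e j - y := by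
    ext j
    simp only [Pi.neg_apply]
    abel
  have h' : ∀ c : Mon, (∀ j ∈ c.support, e j - y ∈ infinitesimals y) →
      ∀ j ∈ c.support, (-e) j - -y ∈ infinitesimals (-y) := fun c hc j hj => by
    rw [infinitesimals_neg, ← neg_mem_iff]
    convert hc j hj using 1
    simp only [Pi.neg_apply]
    abel
  -- Negating the weights reverses comparisons, hence the exchange of `a` and `b`.
  have := value_lt_iff_of_degree_pos (e := -e) (neg_pos.2 hy) (h' b hb) (h' a ha)
  rw [hfun] at this
  simp only [value_neg, neg_lt_neg_iff] at this
  rw [this, eq_comm (a := Finsupp.degree a)]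

end

/-! ### Every nontrivial compatible preorder is listed -/

section

/-- Being one of the listed preorders or an inverse of one. -/
def ListedOrInverse (r : Mon → Mon → Prop) : Prop := Listed r ∨ ∃ s, Listed s ∧ r = inverse s

theorem ListedOrInverse.inverse {r : Mon → Mon → Prop} (h : ListedOrInverse r) :
    ListedOrInverse (inverse r) := by
  rcases h with h | ⟨s, hs, rfl⟩
  · exact Or.inr ⟨r, h, rfl⟩
  · exact Or.inl hs

theorem listed_ordDeg : Listed ordDeg := Or.inl rfl
theorem listed_ordMin : Listed ordMin := Or.inr (Or.inl rfl)
theorem listed_ordDegMin : Listed ordDegMin := Or.inr (Or.inr (Or.inl rfl))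
theorem listed_ordRevdegMin : Listed ordRevdegMin := Or.inr (Or.inr (Or.inr (Or.inl rfl)))
theorem listed_ordMax (i : ℕ+) : Listed (ordMax i) :=
  Or.inr (Or.inr (Or.inr (Or.inr (Or.inl ⟨i, rfl⟩))))
theorem listed_ordDegMax (i : ℕ+) : Listed (ordDegMax i) :=
  Or.inr (Or.inr (Or.inr (Or.inr (Or.inr (Or.inl ⟨i, rfl⟩)))))
theorem listed_ordRevdegMax (i : ℕ+) : Listed (ordRevdegMax i) :=
  Or.inr (Or.inr (Or.inr (Or.inr (Or.inr (Or.inr ⟨i, rfl⟩)))))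

theorem exists_support_lt (a b : Mon) :
    ∃ L : ℕ+, 1 < L ∧ (∀ j ∈ a.support, j < L) ∧ ∀ j ∈ b.support, j < L := by
  obtain ⟨M, hM⟩ := (a.support ∪ b.support ∪ {1}).bddAbove
  have h : ∀ j ∈ a.support ∪ b.support ∪ {1}, j < M + 1 := fun j hj =>
    (hM hj).trans_lt (PNat.lt_add_right M 1)
  exact ⟨M + 1, h 1 (by simp), fun j hj => h j (by simp_all), fun j hj => h j (by simp_all)⟩

variable {G : Type*} [AddCommGroup G] [LinearOrder G] [IsOrderedAddMonoid G] {e : ℕ+ → G}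

theorem Steep.sub_le (hs : Steep e) (hm : Monotone e) (n : ℕ) {j k : ℕ+} (hjk : j < k) :
    n • (e j - e 1) ≤ e k - e 1 := by
  rcases (show 1 ≤ j from one_le).eq_or_lt with rfl | hj
  · simpa using hm hjk.le
  · exact (hs n 1 j k hj hjk).trans (sub_le_sub_left (hm hj.le) _)

/-- With `e 1` as base weight, the corrections `e j - e 1` produce some `Max_i`. The sign and size
of `e 1` decide whether the degree comes before it, and in which direction. -/
theorem listedOrInverse_of_steep (h : ShiftStable e) (hm : Monotone e) (hne : ∃ i, e i ≠ e 1)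
    (hs : Steep e) : ListedOrInverse fun a b => value e a < value e b := by
  obtain ⟨i₀, hi₀⟩ := hne
  have hw : ∃ i, (fun a b => value (fun j => e j - e 1) a < value (fun j => e j - e 1) b) =
      ordMax i := exists_value_lt_iff_ordMax (fun j => sub_nonneg.2 (hm one_le))
        (fun n j k hjk => hs.sub_le hm n hjk) ⟨i₀, sub_ne_zero.2 hi₀⟩
  obtain ⟨i, hi⟩ := hw
  have hi : ∀ a b, value (fun j => e j - e 1) a < value (fun j => e j - e 1) b ↔ ordMax i a b :=
    fun a b => iff_of_eq (congrFun₂ hi a b)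
  rcases h.nonneg_or_nonpos with hpos | hneg
  · rcases h.steep_nonneg hm ⟨i₀, hi₀⟩ hs hpos with hM | hD
    · obtain ⟨i', hi'⟩ := exists_value_lt_iff_ordMax hpos (fun n j k => hM n j k) <| by
        by_contra! hzero
        exact hi₀ ((hzero i₀).trans (hzero 1).symm)
      rw [hi']
      exact Or.inl (listed_ordMax i')
    · have h1 : 0 < e 1 := by
        refine lt_of_le_of_ne (hpos 1) fun h0 => hi₀ (le_antisymm ?_ (hm one_le))
        have := hD 1 i₀
        rwa [one_smul, ← h0, sub_zero, h0] at this
      have hinf : ∀ j, e j - e 1 ∈ infinitesimals (e 1) := fun j =>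
        mem_infinitesimals_of_nonneg (sub_nonneg.2 (hm one_le)) fun n => by
          rw [abs_of_pos h1]; exact hD n j
      have : (fun a b => value e a < value e b) = ordDegMax i := by
        ext a b
        rw [value_lt_iff_of_degree_pos h1 (fun j _ => hinf j) fun j _ => hinf j, hi]
        rfl
      rw [this]
      exact Or.inl (listed_ordDegMax i)
  · have hD := hs.nsmul_sub_le_neg hm hneg
    have h1 : e 1 < 0 := by
      refine lt_of_le_of_ne (hneg 1) fun h0 => hi₀ (le_antisymm ?_ (hm one_le))
      have := hD 1 i₀
      rwa [one_smul, h0, sub_zero, neg_zero, ← h0] at this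
    have hinf : ∀ j, e j - e 1 ∈ infinitesimals (e 1) := fun j =>
      mem_infinitesimals_of_nonneg (sub_nonneg.2 (hm one_le)) fun n => by
        rw [abs_of_neg h1]; exact hD n j
    have : (fun a b => value e a < value e b) = ordRevdegMax i := by
      ext a b
      rw [value_lt_iff_of_degree_neg h1 (fun j _ => hinf j) fun j _ => hinf j, hi]
      rfl
    rw [this]
    exact Or.inl (listed_ordRevdegMax i)

/-- By flatness, one vanishing difference would force all later ones to vanish. -/
theorem ShiftStable.strictMono_of_flat (h : ShiftStable e) (hm : Monotone e)
    (hne : ∃ i, e i ≠ e 1) (hs : Flat e) : StrictMono e := by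
  intro j L hj
  refine lt_of_le_of_ne (hm hj.le) fun heq => ?_
  obtain ⟨i, k, hi, hik, hlt⟩ := h.exists_lt_of_ne hm hne L
  have := hs 1 j L k hj (hi.trans hik)
  rw [one_smul, heq, sub_self, sub_nonpos] at this
  exact (hlt.trans_le (this.trans (hm hi.le))).false

theorem value_sub_lt_iff_ordMin (hsm : StrictMono e) (hs : Flat e) {L : ℕ+} {a b : Mon}
    (ha : ∀ j ∈ a.support, j < L) (hb : ∀ j ∈ b.support, j < L) :
    value (fun j => e j - e L) a < value (fun j => e j - e L) b ↔ ordMin b a := by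
  have := value_lt_iff_ordMin (u := fun j => e L - e j) (fun j hj => sub_pos.2 (hsm hj))
    (fun n j k hjk hk => (hs n j k L hjk hk).trans (sub_le_sub_right (hsm hk).le _)) hb ha
  rw [← this, ← neg_lt_neg_iff, ← value_neg, ← value_neg]
  simp [Pi.neg_def]

/-- Differences shrink along the sequence, so in the degree cases the base weight is `e L` with `L`
beyond both supports, chosen anew for each pair. The corrections `e j - e L` are negative, whence
the inverses of the Min orders. -/
theorem listedOrInverse_of_flat (h : ShiftStable e) (hm : Monotone e) (hne : ∃ i, e i ≠ e 1)
    (hs : Flat e) : ListedOrInverse fun a b => value e a < value e b := by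
  have hsm := h.strictMono_of_flat hm hne hs
  rcases h.nonneg_or_nonpos with hpos | hneg
  · have hD := fun n {j k} => h.flat_nonneg hm hne hs hpos n (j := j) (k := k)
    have : (fun a b => value e a < value e b) = inverse ordRevdegMin := by
      ext a b
      obtain ⟨L, hL, ha, hb⟩ := exists_support_lt a b
      have hLpos : 0 < e L := (hpos 1).trans_lt (hsm hL)
      have hinf : ∀ j, j < L → e j - e L ∈ infinitesimals (e L) := fun j hj => by
        rw [← neg_mem_iff, neg_sub]
        refine mem_infinitesimals_of_nonneg (sub_nonneg.2 (hm hj.le)) fun n => ?_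
        rw [abs_of_pos hLpos]
        exact (hD n hj).trans (hm hj.le)
      rw [value_lt_iff_of_degree_pos hLpos (fun j hj => hinf j (ha j hj))
        (fun j hj => hinf j (hb j hj)), value_sub_lt_iff_ordMin hsm hs ha hb,
        eq_comm (a := Finsupp.degree a)]
      rfl
    rw [this]
    exact Or.inr ⟨_, listed_ordRevdegMin, rfl⟩
  · have hneg' : ∀ j, e j < 0 := fun j => (hsm (PNat.lt_add_right j 1)).trans_le (hneg _)
    rcases h.flat_nonpos hm hne hs hneg with hM | hD
    · have : (fun a b => value e a < value e b) = inverse ordMin := by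
        ext a b
        obtain ⟨L, -, ha, hb⟩ := exists_support_lt a b
        have := value_lt_iff_ordMin (u := -e) (fun j _ => neg_pos.2 (hneg' j))
          (fun n j k hjk _ => hM n j k hjk) hb ha
        rw [value_neg, value_neg, neg_lt_neg_iff] at this
        exact this
      rw [this]
      exact Or.inr ⟨_, listed_ordMin, rfl⟩
    · have : (fun a b => value e a < value e b) = inverse ordDegMin := by
        ext a b
        obtain ⟨L, hL, ha, hb⟩ := exists_support_lt a b
        have hinf : ∀ j, j < L → e j - e L ∈ infinitesimals (e L) := fun j hj => by
          rw [← neg_mem_iff, neg_sub]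
          refine mem_infinitesimals_of_nonneg (sub_nonneg.2 (hm hj.le)) fun n => ?_
          rw [abs_of_neg (hneg' L)]
          -- The extra copy of `e L - e j` turns the bound `-e j` into `-e L`.
          have := hD (n + 1) j L hj
          rw [succ_nsmul] at this
          grind
        rw [value_lt_iff_of_degree_neg (hneg' L) (fun j hj => hinf j (ha j hj))
          (fun j hj => hinf j (hb j hj)), value_sub_lt_iff_ordMin hsm hs ha hb,
          eq_comm (a := Finsupp.degree a)]
        rfl
      rw [this]
      exact Or.inr ⟨_, listed_ordDegMin, rfl⟩

theorem listedOrInverse_of_monotone (h : ShiftStable e) (hm : Monotone e) (h0 : ∃ i, e i ≠ 0) :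
    ListedOrInverse fun a b => value e a < value e b := by
  by_cases hne : ∃ i, e i ≠ e 1
  · exact (h.steep_or_flat hm hne).elim (listedOrInverse_of_steep h hm hne)
      (listedOrInverse_of_flat h hm hne)
  · push Not at hne
    obtain ⟨i, hi⟩ := h0
    rw [hne i] at hi
    have hval : ∀ a, value (fun j => e j - e 1) a = 0 := fun a => by simp [value, hne]
    have hinf : ∀ j, e j - e 1 ∈ infinitesimals (e 1) := fun j => by simp [hne j, zero_mem]
    rcases hi.lt_or_gt with hi | hi
    · have : (fun a b => value e a < value e b) = inverse ordDeg := by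
        ext a b
        rw [value_lt_iff_of_degree_neg hi (fun j _ => hinf j) fun j _ => hinf j, hval, hval]
        simp [inverse, ordDeg]
      rw [this]
      exact Or.inr ⟨_, listed_ordDeg, rfl⟩
    · have : (fun a b => value e a < value e b) = ordDeg := by
        ext a b
        rw [value_lt_iff_of_degree_pos hi (fun j _ => hinf j) fun j _ => hinf j, hval, hval]
        simp [ordDeg]
      rw [this]
      exact Or.inl listed_ordDeg

theorem ShiftStable.listedOrInverse (h : ShiftStable e) (h0 : ∃ i, e i ≠ 0) :
    ListedOrInverse fun a b => value e a < value e b := by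
  rcases h.monotone_or_antitone with hm | hm
  · exact listedOrInverse_of_monotone h hm h0
  · have := (listedOrInverse_of_monotone h.neg hm.neg (by simpa using h0)).inverse
    unfold IncOrders.inverse at this
    simpa only [value_neg, neg_lt_neg_iff] using this

/-- The strictly increasing map widening the gaps at `j` and `k` and shifting by at least `i'`. -/
theorem exists_strictMono_shift {i j k i' j' k' : ℕ+} (hij : i < j) (hjk : j < k) (hij' : i' ≤ j')
    (hjk' : j' ≤ k') :
    ∃ p : ℕ+ → ℕ+, StrictMono p ∧ p i = i + i' ∧ p j = j + j' ∧ p k = k + k' := by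
  refine ⟨fun x => x + if x < j then i' else if x < k then j' else k', fun x y hxy => ?_, ?_, ?_, ?_⟩
  · refine add_lt_add_of_lt_of_le hxy ?_
    have := hij'.trans hjk'
    split_ifs <;> order
  · simp [hij]
  · simp [hjk]
  · simp [hjk.le]

theorem shiftStable_of_incCompatible {r : Mon → Mon → Prop} (hc : IncCompatible r)
    (φ : Mon →+ G) (hφ : ∀ a b, r a b ↔ φ a < φ b) :
    ShiftStable fun j => φ (Finsupp.single j 1) := by
  have hφ1 : ∀ j n, φ (Finsupp.single j n) = n • φ (Finsupp.single j 1) := fun j n => by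
    rw [← map_nsmul, Finsupp.smul_single, smul_eq_mul, mul_one]
  -- Positive and negative parts of the coefficients turn the sign of a combination into a
  -- comparison of two monomials, to which `p` can be applied.
  have hval : ∀ (a b c : ℤ) (i j k : ℕ+),
      0 < a • φ (Finsupp.single i 1) + b • φ (Finsupp.single j 1) + c • φ (Finsupp.single k 1) ↔
      r (Finsupp.single i (-a).toNat + Finsupp.single j (-b).toNat + Finsupp.single k (-c).toNat)
        (Finsupp.single i a.toNat + Finsupp.single j b.toNat + Finsupp.single k c.toNat) := by
    intro a b c i j k
    have hz : ∀ (z : ℤ) (x : G), z • x = z.toNat • x - (-z).toNat • x := fun z x => by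
      rw [← natCast_zsmul, ← natCast_zsmul, ← sub_smul, Int.toNat_sub_toNat_neg]
    rw [hφ, iff_comm, ← sub_pos]
    simp only [map_add, hφ1 _ (Int.toNat _)]
    rw [hz a, hz b, hz c]
    refine iff_of_eq (congrArg _ ?_)
    abel
  intro a b c i j k i' j' k' hij hjk hij' hjk' hpos
  obtain ⟨p, hp, hpi, hpj, hpk⟩ := exists_strictMono_shift hij hjk hij' hjk'
  rw [hval] at hpos ⊢
  have := hc p hp _ _ hpos
  simpa only [act, Finsupp.mapDomain_add, Finsupp.mapDomain_single, hpi, hpj, hpk] using this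

theorem value_single_eq (φ : Mon →+ G) (a : Mon) :
    value (fun j => φ (Finsupp.single j 1)) a = φ a := by
  conv_rhs => rw [← Finsupp.sum_single a]
  rw [value, map_finsuppSum]
  refine Finsupp.sum_congr fun j _ => ?_
  rw [← map_nsmul, Finsupp.smul_single, smul_eq_mul, mul_one]

theorem IsMonomialPreorder.listedOrInverse {r : Mon → Mon → Prop} (hr : IsMonomialPreorder r)
    (hc : IncCompatible r) (ht : ¬ IsTrivial r) : ListedOrInverse r := by
  obtain ⟨G, _, _, _, φ, hφ⟩ := hr.exists_hom
  have h := (shiftStable_of_incCompatible hc φ hφ).listedOrInverse <| by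
    by_contra! h0
    have : ∀ a, φ a = 0 := fun a => by
      rw [← value_single_eq]
      simp [value, h0]
    exact ht fun a b => by simp [Incomparable, hφ, this]
  simp only [value_single_eq, ← hφ] at h
  exact h

end

/-! ### The listed relations are compatible monomial preorders -/

section

/-- Agreement before the deciding index is easier to combine and transport than minimality in
`diffSet`. -/
theorem ordMin_iff {a b : Mon} : ordMin a b ↔ ∃ j, (∀ l < j, a l = b l) ∧ a j < b j := by
  refine exists_congr fun j => ⟨fun ⟨h, hlt⟩ => ⟨fun l hl => ?_, hlt⟩, fun ⟨h, hlt⟩ => ⟨⟨hlt.ne,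
    fun l hl => ?_⟩, hlt⟩⟩
  · by_contra hne
    exact hl.not_ge (h.2 hne)
  · by_contra! hlj
    exact hl (h l hlj)

theorem ordMax_iff {i : ℕ+} {a b : Mon} :
    ordMax i a b ↔ ∃ j, i ≤ j ∧ (∀ l, j < l → a l = b l) ∧ a j < b j := by
  refine exists_congr fun j => ⟨fun ⟨h, hij, hlt⟩ => ⟨hij, fun l hl => ?_, hlt⟩,
    fun ⟨hij, h, hlt⟩ => ⟨⟨hlt.ne, fun l hl => ?_⟩, hij, hlt⟩⟩
  · by_contra hne
    exact hl.not_ge (h.2 hne)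
  · by_contra! hlj
    exact hl (h l hlj)

theorem ordMin_asymm {a b : Mon} (h : ordMin a b) : ¬ ordMin b a := by
  rw [ordMin_iff] at *
  rintro ⟨k, hk⟩
  obtain ⟨j, hj⟩ := h
  rcases lt_trichotomy j k with h | rfl | h <;> grind

theorem ordMax_asymm {i : ℕ+} {a b : Mon} (h : ordMax i a b) : ¬ ordMax i b a := by
  rw [ordMax_iff] at *
  rintro ⟨k, hk⟩
  obtain ⟨j, hj⟩ := h
  rcases lt_trichotomy j k with h | rfl | h <;> grind

theorem incomparable_ordMin_iff {a b : Mon} : Incomparable ordMin a b ↔ a = b := by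
  refine ⟨fun h => ?_, ?_⟩
  · by_contra hab
    exact (ordMin_or_ordMin hab).elim h.1 h.2
  · rintro rfl
    exact ⟨fun h => ordMin_asymm h h, fun h => ordMin_asymm h h⟩

theorem incomparable_ordMax_iff {i : ℕ+} {a b : Mon} :
    Incomparable (ordMax i) a b ↔ ∀ j, i ≤ j → a j = b j := by
  refine ⟨fun h j hij => ?_, fun h => ?_⟩
  · by_contra hab
    exact (ordMax_or_ordMax hij hab).elim h.1 h.2
  · simp only [Incomparable, ordMax_iff]
    grind

theorem isMonomialPreorder_ordMin : IsMonomialPreorder ordMin where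
  irrefl f h := ordMin_asymm h h
  trans f g h h₁ h₂ := by
    rw [ordMin_iff] at *
    obtain ⟨j, hj, hj'⟩ := h₁
    obtain ⟨k, hk, hk'⟩ := h₂
    rcases lt_trichotomy j k with h | rfl | h
    · exact ⟨j, by grind⟩
    · exact ⟨j, by grind⟩
    · exact ⟨k, by grind⟩
  mul f g h := by simp [ordMin_iff]
  cancel f g h := by simp [ordMin_iff]
  incomparable_trans f g h := by
    simp only [incomparable_ordMin_iff]
    exact Eq.trans

theorem isMonomialPreorder_ordMax (i : ℕ+) : IsMonomialPreorder (ordMax i) where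
  irrefl f h := ordMax_asymm h h
  trans f g h h₁ h₂ := by
    rw [ordMax_iff] at *
    obtain ⟨j, hij, hj, hj'⟩ := h₁
    obtain ⟨k, hik, hk, hk'⟩ := h₂
    rcases lt_trichotomy j k with h | rfl | h
    · exact ⟨k, by grind⟩
    · exact ⟨j, by grind⟩
    · exact ⟨j, by grind⟩
  mul f g h := by simp [ordMax_iff]
  cancel f g h := by simp [ordMax_iff]
  incomparable_trans f g h := by
    simp only [incomparable_ordMax_iff]
    exact fun h₁ h₂ j hj => (h₁ j hj).trans (h₂ j hj)

variable {r : Mon → Mon → Prop}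

theorem IsMonomialPreorder.inverse (hr : IsMonomialPreorder r) :
    IsMonomialPreorder (inverse r) where
  irrefl f := hr.irrefl f
  trans _ _ _ h₁ h₂ := hr.trans _ _ _ h₂ h₁
  mul f g h := hr.mul g f h
  cancel f g h := hr.cancel g f h
  incomparable_trans f g h h₁ h₂ := (hr.incomparable_trans f g h h₁.symm h₂.symm).symm

/-- Breaking ties of an additive weight by a relation. -/
def weightLex (d : Mon →+ ℤ) (r : Mon → Mon → Prop) (a b : Mon) : Prop :=
  d a < d b ∨ d a = d b ∧ r a b

theorem incomparable_weightLex_iff {d : Mon →+ ℤ} {a b : Mon} :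
    Incomparable (weightLex d r) a b ↔ d a = d b ∧ Incomparable r a b := by
  simp only [Incomparable, weightLex]
  grind

theorem IsMonomialPreorder.weightLex (hr : IsMonomialPreorder r) (d : Mon →+ ℤ) :
    IsMonomialPreorder (weightLex d r) where
  irrefl f := by simp [IncOrders.weightLex, hr.irrefl]
  trans f g h h₁ h₂ := by
    have := hr.trans f g h
    unfold IncOrders.weightLex at *
    grind
  mul f g h := by simp [IncOrders.weightLex, hr.add_iff]
  cancel f g h := by simp [IncOrders.weightLex, hr.add_iff]
  incomparable_trans f g h := by
    simp only [incomparable_weightLex_iff]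
    exact fun h₁ h₂ => ⟨h₁.1.trans h₂.1, hr.incomparable_trans f g h h₁.2 h₂.2⟩

/-- This is the tie-breaker that makes `ordDeg` an instance of `weightLex`. -/
theorem isMonomialPreorder_empty : IsMonomialPreorder fun _ _ => False where
  irrefl _ h := h
  trans _ _ _ h _ := h
  mul _ _ _ h := h
  cancel _ _ _ h := h
  incomparable_trans _ _ _ h _ := h

theorem degree_act (p : ℕ+ → ℕ+) (a : Mon) :
    Finsupp.degree (act p a) = Finsupp.degree a := by
  simp only [act]
  exact Finsupp.degree_mapDomain p a

/-- The degree with values in the integers. -/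
noncomputable def intDegree : Mon →+ ℤ := (Nat.castAddMonoidHom ℤ).comp Finsupp.degree

theorem intDegree_apply (a : Mon) : intDegree a = ((Finsupp.degree a : ℕ) : ℤ) := rfl

theorem weightLex_intDegree (a b : Mon) : weightLex intDegree r a b ↔
    (Finsupp.degree a < Finsupp.degree b ∨ (Finsupp.degree a = Finsupp.degree b ∧ r a b)) := by
  simp [weightLex, intDegree_apply]

theorem weightLex_neg_intDegree (a b : Mon) : weightLex (-intDegree) r a b ↔
    (Finsupp.degree a > Finsupp.degree b ∨ (Finsupp.degree a = Finsupp.degree b ∧ r a b)) := by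
  simp [weightLex, intDegree_apply]

theorem ordDeg_eq : ordDeg = weightLex intDegree fun _ _ => False := by
  ext a b
  simp [weightLex_intDegree, ordDeg]

theorem ordDegMin_eq : ordDegMin = weightLex intDegree ordMin := by
  ext a b
  exact (weightLex_intDegree a b).symm

theorem ordRevdegMin_eq : ordRevdegMin = weightLex (-intDegree) ordMin := by
  ext a b
  exact (weightLex_neg_intDegree a b).symm

theorem ordDegMax_eq (i : ℕ+) : ordDegMax i = weightLex intDegree (ordMax i) := by
  ext a b
  exact (weightLex_intDegree a b).symm

theorem ordRevdegMax_eq (i : ℕ+) : ordRevdegMax i = weightLex (-intDegree) (ordMax i) := by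
  ext a b
  exact (weightLex_neg_intDegree a b).symm

theorem act_apply {p : ℕ+ → ℕ+} (hp : StrictMono p) (a : Mon) (j : ℕ+) :
    act p a (p j) = a j := Finsupp.mapDomain_apply hp.injective a j

/-- Indices outside the range of `p` carry exponent 0 on both sides. -/
theorem act_eq_of_forall {p : ℕ+ → ℕ+} (hp : StrictMono p) {a b : Mon} {l : ℕ+}
    (h : ∀ m, p m = l → a m = b m) : act p a l = act p b l := by
  by_cases hl : l ∈ Set.range p
  · obtain ⟨m, rfl⟩ := hl
    rw [act_apply hp, act_apply hp, h m rfl]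
  · rw [act, act, Finsupp.mapDomain_of_notMem_range _ _ hl,
      Finsupp.mapDomain_of_notMem_range _ _ hl]

theorem incCompatible_ordMin : IncCompatible ordMin := by
  intro p hp f g h
  rw [ordMin_iff] at *
  obtain ⟨j, hj, hlt⟩ := h
  refine ⟨p j, fun l hl => act_eq_of_forall hp fun m hm => hj m ?_, ?_⟩
  · rwa [← hm, hp.lt_iff_lt] at hl
  · rwa [act_apply hp, act_apply hp]

theorem incCompatible_ordMax (i : ℕ+) : IncCompatible (ordMax i) := by
  intro p hp f g h
  rw [ordMax_iff] at *
  obtain ⟨j, hij, hj, hlt⟩ := h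
  -- Strictly increasing maps satisfy `j ≤ p j`, so the threshold `i` is respected.
  refine ⟨p j, hij.trans hp.le_apply, fun l hl => act_eq_of_forall hp fun m hm => hj m ?_, ?_⟩
  · rwa [← hm, hp.lt_iff_lt] at hl
  · rwa [act_apply hp, act_apply hp]

theorem IncCompatible.inverse (hc : IncCompatible r) : IncCompatible (inverse r) :=
  fun p hp f g h => hc p hp g f h

theorem IncCompatible.weightLex (hc : IncCompatible r) {d : Mon →+ ℤ}
    (hd : ∀ p a, d (act p a) = d a) : IncCompatible (weightLex d r) := by
  intro p hp f g h
  simp only [IncOrders.weightLex, hd] at *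
  exact h.imp_right (And.imp_right (hc p hp f g))

theorem intDegree_act (p : ℕ+ → ℕ+) (a : Mon) : intDegree (act p a) = intDegree a := by
  rw [intDegree_apply, degree_act, intDegree_apply]

theorem neg_intDegree_act (p : ℕ+ → ℕ+) (a : Mon) :
    (-intDegree) (act p a) = (-intDegree) a := by
  rw [AddMonoidHom.neg_apply, intDegree_act, AddMonoidHom.neg_apply]

theorem not_isTrivial_of_rel {a b : Mon} (h : r a b) : ¬ IsTrivial r := fun ht => (ht a b).1 h

theorem ordMax_zero_single {i j : ℕ+} (hij : i ≤ j) {n : ℕ} (hn : 0 < n) :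
    ordMax i 0 (Finsupp.single j n) :=
  ordMax_iff.2 ⟨j, hij, fun l hl => by simp [hl.ne], by simpa using hn⟩

theorem ordMin_zero_single (j : ℕ+) {n : ℕ} (hn : 0 < n) : ordMin 0 (Finsupp.single j n) :=
  ordMin_iff.2 ⟨j, fun l hl => by simp [hl.ne'], by simpa using hn⟩

theorem Listed.spec (h : Listed r) :
    IsMonomialPreorder r ∧ IncCompatible r ∧ ¬ IsTrivial r := by
  rcases h with rfl | rfl | rfl | rfl | ⟨i, rfl⟩ | ⟨i, rfl⟩ | ⟨i, rfl⟩
  · refine ⟨?_, ?_, not_isTrivial_of_rel (a := 0) (b := Finsupp.single 1 1) (by simp [ordDeg])⟩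
    · rw [ordDeg_eq]
      exact isMonomialPreorder_empty.weightLex _
    · rw [ordDeg_eq]
      exact IncCompatible.weightLex (fun _ _ _ _ h => h) intDegree_act
  · exact ⟨isMonomialPreorder_ordMin, incCompatible_ordMin,
      not_isTrivial_of_rel (ordMin_zero_single 1 one_pos)⟩
  · refine ⟨?_, ?_, not_isTrivial_of_rel (a := 0) (b := Finsupp.single 1 1) (by simp [ordDegMin])⟩
    · rw [ordDegMin_eq]
      exact isMonomialPreorder_ordMin.weightLex _
    · rw [ordDegMin_eq]
      exact incCompatible_ordMin.weightLex intDegree_act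
  · refine ⟨?_, ?_,
      not_isTrivial_of_rel (a := Finsupp.single 1 1) (b := 0) (by simp [ordRevdegMin])⟩
    · rw [ordRevdegMin_eq]
      exact isMonomialPreorder_ordMin.weightLex _
    · rw [ordRevdegMin_eq]
      exact incCompatible_ordMin.weightLex neg_intDegree_act
  · exact ⟨isMonomialPreorder_ordMax i, incCompatible_ordMax i,
      not_isTrivial_of_rel (ordMax_zero_single le_rfl one_pos)⟩
  · refine ⟨?_, ?_, not_isTrivial_of_rel (a := 0) (b := Finsupp.single 1 1) (by simp [ordDegMax])⟩
    · rw [ordDegMax_eq]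
      exact (isMonomialPreorder_ordMax i).weightLex _
    · rw [ordDegMax_eq]
      exact (incCompatible_ordMax i).weightLex intDegree_act
  · refine ⟨?_, ?_,
      not_isTrivial_of_rel (a := Finsupp.single 1 1) (b := 0) (by simp [ordRevdegMax])⟩
    · rw [ordRevdegMax_eq]
      exact (isMonomialPreorder_ordMax i).weightLex _
    · rw [ordRevdegMax_eq]
      exact (incCompatible_ordMax i).weightLex neg_intDegree_act

theorem ListedOrInverse.spec (h : ListedOrInverse r) :
    IsMonomialPreorder r ∧ IncCompatible r ∧ ¬ IsTrivial r := by
  rcases h with h | ⟨s, hs, rfl⟩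
  · exact h.spec
  · obtain ⟨h₁, h₂, h₃⟩ := hs.spec
    exact ⟨h₁.inverse, h₂.inverse, fun ht => h₃ fun f g => (ht f g).symm⟩

/-- A nontrivial `Inc(ℕ)`-compatible monomial preorder is a listed one or an inverse of one. -/
theorem isMonomialPreorder_incCompatible_iff (r : Mon → Mon → Prop) :
    (IsMonomialPreorder r ∧ IncCompatible r ∧ ¬ IsTrivial r) ↔ ListedOrInverse r :=
  ⟨fun h => h.1.listedOrInverse h.2.1 h.2.2, ListedOrInverse.spec⟩

end

/-! ### Compatible term orders -/

section

variable {r : Mon → Mon → Prop} {le : Mon → Mon → Prop}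

/-- The monomial preorders whose associated weak relation is a term order. -/
structure IsStrictTermOrder (r : Mon → Mon → Prop) : Prop extends IsMonomialPreorder r where
  eq_of_incomparable : ∀ f g, Incomparable r f g → f = g
  zero_rel : ∀ f, f ≠ 0 → r 0 f

theorem weak_injective : Function.Injective weak := by
  intro r s h
  ext f g
  exact not_iff_not.1 (iff_of_eq (congrFun₂ h g f))

/-- The same operation thus passes from total orders to strict ones and back. -/
theorem weak_weak (r : Mon → Mon → Prop) : weak (weak r) = r := by
  ext f g
  exact not_not

theorem act_injective {p : ℕ+ → ℕ+} (hp : StrictMono p) : Function.Injective (act p) :=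
  Finsupp.mapDomain_injective hp.injective

theorem IsTermOrder.isStrictTermOrder_weak (h : IsTermOrder le) : IsStrictTermOrder (weak le) where
  irrefl f hf := hf (h.refl f)
  trans f g k h₁ h₂ h₃ := h₂ (h.trans _ _ _ h₃ ((h.total f g).resolve_right h₁))
  mul f g k h₁ h₂ := by
    have hfg := h.mul _ _ k ((h.total f g).resolve_right h₁)
    have := add_left_cancel (h.antisymm _ _ hfg h₂)
    exact h₁ (this ▸ h.refl f)
  cancel f g k h₁ h₂ := h₁ (h.mul _ _ k h₂)
  incomparable_trans f g k h₁ h₂ := by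
    have e₁ := h.antisymm _ _ (not_not.1 h₁.2) (not_not.1 h₁.1)
    exact e₁ ▸ h₂
  eq_of_incomparable f g h₁ := h.antisymm _ _ (not_not.1 h₁.2) (not_not.1 h₁.1)
  zero_rel f hf h₁ := hf (h.antisymm _ _ h₁ (h.one_le f))

/-- Injectivity of the action keeps strict inequalities strict. -/
theorem IsTermOrder.incCompatible_weak (h : IsTermOrder le) (hc : IncCompatible le) :
    IncCompatible (weak le) := by
  intro p hp f g h₁ h₂
  have hfg := hc p hp f g ((h.total f g).resolve_right h₁)
  have := act_injective hp (h.antisymm _ _ hfg h₂)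
  exact h₁ (this ▸ h.refl f)

theorem IsStrictTermOrder.not_isTrivial (h : IsStrictTermOrder r) : ¬ IsTrivial r :=
  not_isTrivial_of_rel (h.zero_rel (Finsupp.single 1 1) (by simp))

theorem IsStrictTermOrder.eq_or_rel (h : IsStrictTermOrder r) {f g : Mon} (h₁ : ¬ r g f) :
    f = g ∨ r f g := by
  by_cases h₂ : r f g
  · exact Or.inr h₂
  · exact Or.inl (h.eq_of_incomparable f g ⟨h₂, h₁⟩)

theorem IsStrictTermOrder.isTermOrder_weak (h : IsStrictTermOrder r) : IsTermOrder (weak r) where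
  refl f := h.irrefl f
  antisymm f g h₁ h₂ := h.eq_of_incomparable f g ⟨h₂, h₁⟩
  trans f g k h₁ h₂ := h.toIsMonomialPreorder.not_trans h₁ h₂
  total f g := or_iff_not_imp_left.2 fun h₁ => h.toIsMonomialPreorder.asymm (not_not.1 h₁)
  mul f g k h₁ h₂ := h₁ (h.cancel _ _ k h₂)
  one_le f h₁ := by
    by_cases hf : f = 0
    · exact h.irrefl 0 (hf ▸ h₁)
    · exact h.toIsMonomialPreorder.asymm (h.zero_rel f hf) h₁

theorem IsStrictTermOrder.incCompatible_weak (h : IsStrictTermOrder r) (hc : IncCompatible r) :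
    IncCompatible (weak r) := by
  intro p hp f g h₁
  rcases h.eq_or_rel h₁ with rfl | h₂
  · exact h.irrefl _
  · exact h.toIsMonomialPreorder.asymm (hc p hp f g h₂)

/-- The degree and the other exponents determine the exponent of `x₁`. Hence thresholds 1 and 2
coincide once ties are broken within a degree. -/
theorem eq_of_degree_eq {a b : Mon} (hd : Finsupp.degree a = Finsupp.degree b)
    (h : ∀ j, 1 < j → a j = b j) : a = b := by
  have he : a.erase 1 = b.erase 1 := by
    ext j
    rcases (show 1 ≤ j from one_le).eq_or_lt with rfl | hj
    · simp
    · rw [Finsupp.erase_ne hj.ne', Finsupp.erase_ne hj.ne', h j hj]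
  rw [← Finsupp.single_add_erase 1 a, ← Finsupp.single_add_erase 1 b, he] at hd ⊢
  have h1 : a 1 = b 1 := by simpa using hd
  rw [h1]

theorem ordMax_one_iff {a b : Mon} (hd : Finsupp.degree a = Finsupp.degree b) :
    ordMax 1 a b ↔ ordMax 2 a b := by
  rw [ordMax_iff, ordMax_iff]
  refine exists_congr fun j => ⟨fun ⟨_, h, hlt⟩ => ⟨?_, h, hlt⟩, fun ⟨_, h⟩ => ⟨one_le, h⟩⟩
  by_contra! hj
  have hj1 : j = 1 := le_antisymm (PNat.lt_add_one_iff.1 hj) one_le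
  subst hj1
  rw [eq_of_degree_eq hd h] at hlt
  exact lt_irrefl _ hlt

theorem ordDegMax_one : ordDegMax 1 = ordDegMax 2 := by
  ext a b
  exact or_congr_right (and_congr_right ordMax_one_iff)

theorem ordRevdegMax_one : ordRevdegMax 1 = ordRevdegMax 2 := by
  ext a b
  exact or_congr_right (and_congr_right ordMax_one_iff)

theorem incomparable_inverse_iff {a b : Mon} :
    Incomparable (inverse r) a b ↔ Incomparable r a b := and_comm

theorem degree_pos {f : Mon} (hf : f ≠ 0) : 0 < Finsupp.degree f :=
  Nat.pos_of_ne_zero (by rwa [Ne, Finsupp.degree_eq_zero_iff])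

theorem isStrictTermOrder_ordMin : IsStrictTermOrder ordMin where
  __ := isMonomialPreorder_ordMin
  eq_of_incomparable _ _ h := incomparable_ordMin_iff.1 h
  zero_rel f hf := (ordMin_or_ordMin hf.symm).resolve_right fun h => by
    obtain ⟨j, -, hj⟩ := h
    exact Nat.not_lt_zero _ hj

theorem isStrictTermOrder_ordMax_one : IsStrictTermOrder (ordMax 1) where
  __ := isMonomialPreorder_ordMax 1
  eq_of_incomparable _ _ h := Finsupp.ext fun j => incomparable_ordMax_iff.1 h j one_le
  zero_rel f hf := by
    obtain ⟨j, hj⟩ := Finsupp.ne_iff.1 hf.symm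
    refine (ordMax_or_ordMax one_le hj).resolve_right fun h => ?_
    obtain ⟨j, -, -, hj⟩ := h
    exact Nat.not_lt_zero _ hj

theorem eq_of_incomparable_ordMax_two {a b : Mon} (hd : Finsupp.degree a = Finsupp.degree b)
    (h : Incomparable (ordMax 2) a b) : a = b :=
  eq_of_degree_eq hd fun j hj => incomparable_ordMax_iff.1 h j (PNat.add_one_le_iff.2 hj)

theorem isStrictTermOrder_ordDegMin : IsStrictTermOrder ordDegMin where
  __ := (listed_ordDegMin.spec).1
  eq_of_incomparable a b h := by
    rw [ordDegMin_eq, incomparable_weightLex_iff] at h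
    exact incomparable_ordMin_iff.1 h.2
  zero_rel f hf := Or.inl (by simpa using degree_pos hf)

theorem isStrictTermOrder_inverse_ordRevdegMin : IsStrictTermOrder (inverse ordRevdegMin) where
  __ := (listed_ordRevdegMin.spec).1.inverse
  eq_of_incomparable a b h := by
    rw [incomparable_inverse_iff, ordRevdegMin_eq, incomparable_weightLex_iff] at h
    exact incomparable_ordMin_iff.1 h.2
  zero_rel f hf := Or.inl (by simpa using degree_pos hf)

theorem isStrictTermOrder_ordDegMax_two : IsStrictTermOrder (ordDegMax 2) where
  __ := (listed_ordDegMax 2).spec.1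
  eq_of_incomparable a b h := by
    rw [ordDegMax_eq, incomparable_weightLex_iff] at h
    exact eq_of_incomparable_ordMax_two (by simpa [intDegree_apply] using h.1) h.2
  zero_rel f hf := Or.inl (by simpa using degree_pos hf)

theorem isStrictTermOrder_inverse_ordRevdegMax_two :
    IsStrictTermOrder (inverse (ordRevdegMax 2)) where
  __ := (listed_ordRevdegMax 2).spec.1.inverse
  eq_of_incomparable a b h := by
    rw [incomparable_inverse_iff, ordRevdegMax_eq, incomparable_weightLex_iff] at h
    exact eq_of_incomparable_ordMax_two (by simpa [intDegree_apply] using h.1) h.2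
  zero_rel f hf := Or.inl (by simpa using degree_pos hf)

theorem incomparable_single_ordMax {i j k : ℕ+} (hj : j < i) (hk : k < i) (m n : ℕ) :
    Incomparable (ordMax i) (Finsupp.single j m) (Finsupp.single k n) :=
  incomparable_ordMax_iff.2 fun l hl => by
    simp [(hj.trans_le hl).ne, (hk.trans_le hl).ne]

theorem single_one_ne_single_two : (Finsupp.single 1 1 : Mon) ≠ Finsupp.single 2 1 := by
  intro h
  simpa using DFunLike.congr_fun h 1

/-- If ties in degree are broken by `Max_i` and distinct monomials are comparable then `i ≤ 2`. -/
theorem le_two_of_eq_of_incomparable {i : ℕ+} {d : Mon →+ ℤ}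
    (hd : d (Finsupp.single 1 1) = d (Finsupp.single 2 1))
    (h : ∀ f g, Incomparable (weightLex d (ordMax i)) f g → f = g) : i = 1 ∨ i = 2 := by
  have hi : i ≤ 2 := by
    by_contra! hi
    exact single_one_ne_single_two (h _ _ (incomparable_weightLex_iff.2
      ⟨hd, incomparable_single_ordMax ((by decide : (1 : ℕ+) < 2).trans hi) hi 1 1⟩))
  rcases hi.eq_or_lt with rfl | hi
  · exact Or.inr rfl
  · exact Or.inl (le_antisymm (PNat.lt_add_one_iff.1 hi) one_le)

theorem IsStrictTermOrder.not_rel_zero (h : IsStrictTermOrder r) (f : Mon) : ¬ r f 0 := by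
  rcases eq_or_ne f 0 with rfl | hf
  · exact h.irrefl 0
  · exact h.toIsMonomialPreorder.asymm (h.zero_rel f hf)

/-- Each excluded preorder either places a variable below `1` or leaves two distinct monomials
incomparable. -/
theorem IsStrictTermOrder.classification (h : IsStrictTermOrder r) (hc : IncCompatible r) :
    r = ordMin ∨ r = ordDegMin ∨ r = inverse ordRevdegMin ∨ r = ordMax 1 ∨ r = ordDegMax 2 ∨
      r = inverse (ordRevdegMax 2) := by
  have hx := h.not_rel_zero
  have heq := h.eq_of_incomparable
  rcases h.toIsMonomialPreorder.listedOrInverse hc h.not_isTrivial with hl | ⟨s, hl, rfl⟩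
  · rcases hl with rfl | rfl | rfl | rfl | ⟨i, rfl⟩ | ⟨i, rfl⟩ | ⟨i, rfl⟩
    · refine absurd (heq (Finsupp.single 1 1) (Finsupp.single 2 1) ?_) single_one_ne_single_two
      simp [Incomparable, ordDeg]
    · simp
    · simp
    · exact absurd (Or.inl (by simp)) (hx (Finsupp.single 1 1))
    · rcases (show 1 ≤ i from one_le).eq_or_lt with rfl | hi
      · simp
      -- For `1 < i`, `Max_i` does not see `x₁`, so it cannot separate `x₁` from `1 = x₁⁰`.
      · have := heq 0 (Finsupp.single 1 1) (by
          simpa using incomparable_single_ordMax hi hi 0 1)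
        simp [eq_comm] at this
    · rw [ordDegMax_eq] at heq
      rcases le_two_of_eq_of_incomparable (by simp [intDegree_apply]) heq with rfl | rfl
      · simp [ordDegMax_one]
      · simp
    · exact absurd (Or.inl (by simp)) (hx (Finsupp.single 1 1))
  · rcases hl with rfl | rfl | rfl | rfl | ⟨i, rfl⟩ | ⟨i, rfl⟩ | ⟨i, rfl⟩
    · exact absurd (by simp [inverse, ordDeg]) (hx (Finsupp.single 1 1))
    · exact absurd (ordMin_zero_single 1 one_pos) (hx (Finsupp.single 1 1))
    · exact absurd (Or.inl (by simp)) (hx (Finsupp.single 1 1))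
    · simp
    · exact absurd (ordMax_zero_single le_rfl one_pos) (hx (Finsupp.single i 1))
    · exact absurd (Or.inl (by simp)) (hx (Finsupp.single 1 1))
    · simp only [incomparable_inverse_iff, ordRevdegMax_eq] at heq
      rcases le_two_of_eq_of_incomparable (by simp [intDegree_apply]) heq with rfl | rfl
      · simp [ordRevdegMax_one]
      · simp

theorem setOf_isTermOrder_incCompatible :
    {le | IsTermOrder le ∧ IncCompatible le} =
      {weak ordMin, weak ordDegMin, weak (inverse ordRevdegMin), weak (ordMax 1),
       weak (ordDegMax 2), weak (inverse (ordRevdegMax 2))} := by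
  ext le
  simp only [Set.mem_ofPred_eq, Set.mem_insert_iff, Set.mem_singleton_iff]
  constructor
  · rintro ⟨h, hc⟩
    have := h.isStrictTermOrder_weak.classification (h.incCompatible_weak hc)
    rw [← weak_weak le]
    rcases this with h | h | h | h | h | h <;> simp [h]
  · have key : ∀ {r}, IsStrictTermOrder r → IncCompatible r →
        IsTermOrder (weak r) ∧ IncCompatible (weak r) :=
      fun h hc => ⟨h.isTermOrder_weak, h.incCompatible_weak hc⟩
    rintro (rfl | rfl | rfl | rfl | rfl | rfl)
    · exact key isStrictTermOrder_ordMin listed_ordMin.spec.2.1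
    · exact key isStrictTermOrder_ordDegMin listed_ordDegMin.spec.2.1
    · exact key isStrictTermOrder_inverse_ordRevdegMin listed_ordRevdegMin.spec.2.1.inverse
    · exact key isStrictTermOrder_ordMax_one (listed_ordMax 1).spec.2.1
    · exact key isStrictTermOrder_ordDegMax_two (listed_ordDegMax 2).spec.2.1
    · exact key isStrictTermOrder_inverse_ordRevdegMax_two (listed_ordRevdegMax 2).spec.2.1.inverse

/-- The comparisons `x₁ ≺ x₂`, `x₁ ≺ x₂²`, `x₁² ≺ x₂` and `x₁ x₃ ≺ x₂²`. -/
def testComparisons (r : Mon → Mon → Prop) : Prop × Prop × Prop × Prop :=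
  (r (Finsupp.single 1 1) (Finsupp.single 2 1), r (Finsupp.single 1 1) (Finsupp.single 2 2),
    r (Finsupp.single 1 2) (Finsupp.single 2 1),
    r (Finsupp.single 1 1 + Finsupp.single 3 1) (Finsupp.single 2 2))

theorem not_ordMin_of_lt {a b : Mon} (h : b 1 < a 1) : ¬ ordMin a b :=
  ordMin_asymm (ordMin_iff.2 ⟨1, fun _ hl => absurd hl (not_lt_one), h⟩)

theorem ordMin_of_lt {a b : Mon} (h : a 1 < b 1) : ordMin a b :=
  ordMin_iff.2 ⟨1, fun _ hl => absurd hl (not_lt_one), h⟩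

theorem ordMax_single_single {i j k : ℕ+} (hi : i ≤ k) (hjk : j < k) (m : ℕ) {n : ℕ}
    (hn : 0 < n) : ordMax i (Finsupp.single j m) (Finsupp.single k n) :=
  ordMax_iff.2 ⟨k, hi, fun l hl => by simp [hl.ne, (hjk.trans hl).ne], by
    simpa [hjk.ne] using hn⟩

theorem ordMax_two_test : ordMax 2 (Finsupp.single 2 2)
    (Finsupp.single 1 1 + Finsupp.single 3 1) :=
  ordMax_iff.2 ⟨3, by decide, fun l hl => by
    have h2 : 2 < l := lt_trans (by decide) hl
    have h1 : 1 < l := lt_trans (by decide) hl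
    simp [hl.ne, h1.ne, h2.ne], by simp⟩

theorem ordMin_test : ordMin (Finsupp.single 2 2 : Mon)
    (Finsupp.single 1 1 + Finsupp.single 3 1) := ordMin_of_lt (by simp)

theorem testComparisons_ordMin : testComparisons ordMin = (False, False, False, False) := by
  simp only [testComparisons, Prod.mk.injEq, eq_iff_iff, iff_false]
  exact ⟨not_ordMin_of_lt (by simp), not_ordMin_of_lt (by simp), not_ordMin_of_lt (by simp),
    ordMin_asymm ordMin_test⟩

theorem testComparisons_ordDegMin :
    testComparisons ordDegMin = (False, True, False, False) := by
  have h₁ : ¬ ordMin (Finsupp.single 1 1) (Finsupp.single 2 1) := not_ordMin_of_lt (by simp)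
  simp [testComparisons, ordDegMin, h₁, ordMin_asymm ordMin_test]

theorem testComparisons_inverse_ordRevdegMin :
    testComparisons (inverse ordRevdegMin) = (True, True, False, True) := by
  have h₁ : ordMin (Finsupp.single 2 1) (Finsupp.single 1 1) := ordMin_of_lt (by simp)
  simp [testComparisons, inverse, ordRevdegMin, h₁, ordMin_test]

theorem testComparisons_ordMax_one :
    testComparisons (ordMax 1) = (True, True, True, False) := by
  have h : ordMax 1 (Finsupp.single 2 2) (Finsupp.single 1 1 + Finsupp.single 3 1) := by
    obtain ⟨j, hj, -, hlt⟩ := ordMax_two_test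
    exact ⟨j, hj, one_le, hlt⟩
  simp only [testComparisons, Prod.mk.injEq, eq_iff_iff, iff_false, iff_true]
  exact ⟨ordMax_single_single one_le (by decide) 1 one_pos,
    ordMax_single_single one_le (by decide) 1 two_pos,
    ordMax_single_single one_le (by decide) 2 one_pos, ordMax_asymm h⟩

theorem testComparisons_ordDegMax_two :
    testComparisons (ordDegMax 2) = (True, True, False, False) := by
  have h₁ : ordMax 2 (Finsupp.single 1 1) (Finsupp.single 2 1) :=
    ordMax_single_single le_rfl (by decide) 1 one_pos
  simp [testComparisons, ordDegMax, h₁, ordMax_asymm ordMax_two_test]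

theorem testComparisons_inverse_ordRevdegMax_two :
    testComparisons (inverse (ordRevdegMax 2)) = (False, True, False, True) := by
  have h₁ : ¬ ordMax 2 (Finsupp.single 2 1) (Finsupp.single 1 1) :=
    ordMax_asymm (ordMax_single_single le_rfl (by decide) 1 one_pos)
  simp [testComparisons, inverse, ordRevdegMax, h₁, ordMax_two_test]

/-- The four test comparisons give six different truth patterns, and `weak` is injective. -/
theorem ncard_termOrders :
    ({weak ordMin, weak ordDegMin, weak (inverse ordRevdegMin), weak (ordMax 1),
      weak (ordDegMax 2), weak (inverse (ordRevdegMax 2))} : Set (Mon → Mon → Prop)).ncard = 6 := by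
  have key : ∀ {r s : Mon → Mon → Prop}, testComparisons r ≠ testComparisons s →
      weak r ≠ weak s := fun h h' => h (congrArg _ (weak_injective h'))
  rw [Set.ncard_insert_of_notMem, Set.ncard_insert_of_notMem, Set.ncard_insert_of_notMem,
    Set.ncard_insert_of_notMem, Set.ncard_insert_of_notMem, Set.ncard_singleton]
  all_goals
    simp only [Set.mem_insert_iff, Set.mem_singleton_iff, not_or]
    repeat' apply And.intro
  all_goals
    apply key
    simp [testComparisons_ordMin, testComparisons_ordDegMin,
      testComparisons_inverse_ordRevdegMin, testComparisons_ordMax_one,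
      testComparisons_ordDegMax_two, testComparisons_inverse_ordRevdegMax_two]

end

end IncOrders

theorem mainTheorem4 :
    (∀ r : IncOrders.Mon → IncOrders.Mon → Prop,
      (IncOrders.IsMonomialPreorder r ∧ IncOrders.IncCompatible r ∧ ¬ IncOrders.IsTrivial r) ↔
        (IncOrders.Listed r ∨ ∃ s, IncOrders.Listed s ∧ r = IncOrders.inverse s)) ∧
    {le | IncOrders.IsTermOrder le ∧ IncOrders.IncCompatible le} =
      {IncOrders.weak IncOrders.ordMin,
       IncOrders.weak IncOrders.ordDegMin,
       IncOrders.weak (IncOrders.inverse IncOrders.ordRevdegMin),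
       IncOrders.weak (IncOrders.ordMax 1),
       IncOrders.weak (IncOrders.ordDegMax 2),
       IncOrders.weak (IncOrders.inverse (IncOrders.ordRevdegMax 2))} ∧
    {le | IncOrders.IsTermOrder le ∧ IncOrders.IncCompatible le}.ncard = 6 :=
  ⟨IncOrders.isMonomialPreorder_incCompatible_iff, IncOrders.setOf_isTermOrder_incCompatible,
    IncOrders.setOf_isTermOrder_incCompatible ▸ IncOrders.ncard_termOrders⟩
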